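/- Let $\rho_0,\rho_1$ be probability densities on $\mathbb R^d$ that are strictly positive, of class $C^2$, and satisfy $\int|\nabla\log\rho_i|^2\rho_i\,dx<\infty$ for $i=0,1$. Let $I:[0,1]\times\mathbb R^d\times\mathbb R^d\to\mathbb R^d$ be $C^2$ in $t$ for each fixed $(x_0,x_1)$ and $C^2$ in $(x_0,x_1)$ for each fixed $t$, with $I(0,x_0,x_1)=x_0$, $I(1,x_0,x_1)=x_1$ and $|\partial_tI(t,x_0,x_1)|\le C_1|x_0-x_1|$ for some constant $C_1$. Let $\gamma:[0,1]\to\mathbb R$ satisfy $\gamma(0)=\gamma(1)=0$, $\gamma>0$ on $(0,1)$ and $\gamma^2\in C^2([0,1])$. Let $(x_0,x_1)$ have a joint law $\nu$ with marginals $\rho_0(x)\,dx$ and $\rho_1(x)\,dx$, let $z\sim N(0,\mathrm{Id})$ be independent of $(x_0,x_1)$, and suppose that there are constants $M_1,M_2<\infty$ with $\mathbb E|\partial_tI(t,x_0,x_1)|^4\le M_1$ and $\mathbb E|\partial_t^2I(t,x_0,x_1)|^2\le M_2$ for all $t\in[0,1]$. Put $x_t=I(t,x_0,x_1)+\gamma(t)z$.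 Then for every $t\in[0,1]$ the law of $x_t$ is absolutely continuous with respect to Lebesgue measure, and there are a density $\rho(t,\cdot)$ of this law and a velocity $b(t,\cdot):\mathbb R^d\to\mathbb R^d$, $t\in[0,1]$, such that: 1. $\rho(0)=\rho_0$, $\rho(1)=\rho_1$, $\rho(t,x)>0$ for all $(t,x)\in[0,1]\times\mathbb R^d$, and $\rho\in C^1((0,1);C^p(\mathbb R^d))$ for every $p\in\mathbb N$. 2. $\gamma$ is differentiable on $(0,1)$, and $b(t,x)=\mathbb E[\partial_tI(t,x_0,x_1)+\dot\gamma(t)z\mid x_t=x]$ for all $t\in(0,1)$, and also for $t\in\{0,1\}$ if the one-sided derivative $\dot\gamma(t)$ exists. In any case, for $t\in\{0,1\}$, $b(t,x)=\mathbb E[\partial_tI(t,x_0,x_1)\mid x_t=x]-\tfrac12(\gamma^2)'(t)\,\nabla\log\rho(t,x)$. The random vectors whose conditional expectations appear here are integrable. 3. $\partial_t\rho+\nabla\cdot(b\rho)=0$ holds pointwise on $(0,1)\times\mathbb R^d$. Moreover, for every $\varphi\in C_c^\infty(\mathbb R^d)$ and every $t\in[0,1]$, $\frac{d}{dt}\int\varphi\,\rho(t)\,dx=\int\nabla\varphi\cdot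 b(t)\,\rho(t)\,dx$, with one-sided derivatives at $t=0,1$. 4. $b\in C^0((0,1);(C^p(\mathbb R^d))^d)$ for every $p\in\mathbb N$, and for every $\psi\in C_c^\infty(\mathbb R^d;\mathbb R^d)$ the function $t\mapsto\int\psi\cdot b(t)\,\rho(t)\,dx$ is continuous on $[0,1]$. 5. $\int_{\mathbb R^d}|b(t,x)|^2\rho(t,x)\,dx<\infty$ for every $t\in[0,1]$. Here $u\in C^0((0,1);C^p)$ means that each $u(t,\cdot)$ is $C^p$ and that all spatial derivatives of order at most $p$ are jointly continuous in $(t,x)\in(0,1)\times\mathbb R^d$; $u\in C^1((0,1);C^p)$ means that both $u$ and $\partial_tu$ have this property. -/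

import Mathlib

open MeasureTheory ProbabilityTheory Set
open scoped ENNReal NNReal ContDiff Gradient

/-- `R^d` with its Euclidean norm. -/
abbrev Rd (d : ℕ) := EuclideanSpace ℝ (Fin d)

namespace Interpolant

noncomputable section

/-- A probability density function on `R^d` with respect to Lebesgue measure. -/
structure IsProbDensity {d : ℕ} (ρ : Rd d → ℝ) : Prop where
  measurable : Measurable ρ
  nonneg : ∀ x, 0 ≤ ρ x
  lintegral_eq_one : ∫⁻ x, ENNReal.ofReal (ρ x) = 1

/-- The measure `ρ(x) dx`. -/
def densityMeasure {d : ℕ} (ρ : Rd d → ℝ) : Measure (Rd d) :=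
  volume.withDensity fun x => ENNReal.ofReal (ρ x)

/-- `∂ₜ I(t, x₀, x₁)` for `t ∈ [0,1]` (one-sided at the endpoints). -/
def dtI {d : ℕ} (I : ℝ → Rd d → Rd d → Rd d) (t : ℝ) (x₀ x₁ : Rd d) : Rd d :=
  derivWithin (fun s => I s x₀ x₁) (Icc 0 1) t

/-- `∂ₜ² I(t, x₀, x₁)` for `t ∈ [0,1]` (one-sided at the endpoints). -/
def dttI {d : ℕ} (I : ℝ → Rd d → Rd d → Rd d) (t : ℝ) (x₀ x₁ : Rd d) : Rd d :=
  iteratedDerivWithin 2 (fun s => I s x₀ x₁) (Icc 0 1) t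

/-- Conditions on the deterministic interpolation map `I`: twice continuously differentiable in
`t` for fixed `(x₀, x₁)` and in `(x₀, x₁)` for fixed `t`, with the boundary values `x₀`, `x₁` and
speed at most `C₁ |x₀ - x₁|`. Only the values for `t ∈ [0,1]` matter. -/
structure IsInterpolationMap {d : ℕ} (I : ℝ → Rd d → Rd d → Rd d) : Prop where
  contDiff_time : ∀ x₀ x₁, ContDiffOn ℝ 2 (fun t => I t x₀ x₁) (Icc 0 1)
  contDiff_space : ∀ t ∈ Icc (0 : ℝ) 1, ContDiff ℝ 2 fun q : Rd d × Rd d => I t q.1 q.2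
  at_zero : ∀ x₀ x₁, I 0 x₀ x₁ = x₀
  at_one : ∀ x₀ x₁, I 1 x₀ x₁ = x₁
  speed_le : ∃ C₁ : ℝ, ∀ t ∈ Icc (0 : ℝ) 1, ∀ x₀ x₁, ‖dtI I t x₀ x₁‖ ≤ C₁ * ‖x₀ - x₁‖

/-- Conditions on the amplitude `γ` of the latent variable. -/
structure IsLatentScale (γ : ℝ → ℝ) : Prop where
  at_zero : γ 0 = 0
  at_one : γ 1 = 0
  pos : ∀ t ∈ Ioo (0 : ℝ) 1, 0 < γ t
  contDiff_sq : ContDiffOn ℝ 2 (fun t => γ t ^ 2) (Icc 0 1)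

/-- `ν` is a coupling of `ρ₀(x) dx` and `ρ₁(x) dx`. -/
structure IsCoupling {d : ℕ} (ν : Measure (Rd d × Rd d)) (ρ₀ ρ₁ : Rd d → ℝ) : Prop where
  fst_eq : ν.map Prod.fst = densityMeasure ρ₀
  snd_eq : ν.map Prod.snd = densityMeasure ρ₁

/-- `(x₀, x₁) ∼ ν` and `z ∼ N(0, Id)`, with `z` independent of `(x₀, x₁)`. -/
structure IsSample {d : ℕ} {Ω : Type*} [MeasurableSpace Ω] (P : Measure Ω)
    (ν : Measure (Rd d × Rd d)) (X₀ X₁ Z : Ω → Rd d) : Prop where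
  measurable_fst : Measurable X₀
  measurable_snd : Measurable X₁
  measurable_latent : Measurable Z
  law_pair : P.map (fun w => (X₀ w, X₁ w)) = ν
  law_latent : P.map Z = stdGaussian (Rd d)
  indep : IndepFun (fun w => (X₀ w, X₁ w)) Z P

/-- Positive `C²` density with finite Fisher information. -/
structure IsRegularDensity {d : ℕ} (ρ : Rd d → ℝ) : Prop where
  pos : ∀ x, 0 < ρ x
  contDiff : ContDiff ℝ 2 ρ
  fisher : Integrable fun x => ‖∇ (fun y => Real.log (ρ y)) x‖ ^ 2 * ρ x

/-- Uniform moment bounds `E|∂ₜI|⁴ ≤ M₁` and `E|∂ₜ²I|² ≤ M₂` on `[0,1]`. -/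
structure HasMomentBounds {d : ℕ} (ν : Measure (Rd d × Rd d))
    (I : ℝ → Rd d → Rd d → Rd d) : Prop where
  fourth : ∃ M₁ : ℝ≥0, ∀ t ∈ Icc (0 : ℝ) 1, ∫⁻ q, ‖dtI I t q.1 q.2‖ₑ ^ 4 ∂ν ≤ M₁
  second : ∃ M₂ : ℝ≥0, ∀ t ∈ Icc (0 : ℝ) 1, ∫⁻ q, ‖dttI I t q.1 q.2‖ₑ ^ 2 ∂ν ≤ M₂

/-- The stochastic interpolant `x_t = I(t, x₀, x₁) + γ(t) z`. -/
def process {d : ℕ} {Ω : Type*} (I : ℝ → Rd d → Rd d → Rd d) (γ : ℝ → ℝ) (X₀ X₁ Z : Ω → Rd d)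
    (t : ℝ) (w : Ω) : Rd d :=
  I t (X₀ w) (X₁ w) + γ t • Z w

/-- `∂ₜ I(t, x₀, x₁) + γ'(t) z`. -/
def processVelocity {d : ℕ} {Ω : Type*} (I : ℝ → Rd d → Rd d → Rd d) (γ : ℝ → ℝ)
    (X₀ X₁ Z : Ω → Rd d) (t : ℝ) (w : Ω) : Rd d :=
  dtI I t (X₀ w) (X₁ w) + derivWithin γ (Icc 0 1) t • Z w

/-- `f(x) = E[Y | X = x]`: `Y` is integrable, `f` is measurable, and `f(X)` is a version of
the conditional expectation of `Y` given the σ-algebra generated by `X`. -/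
def IsCondExpGiven {d : ℕ} {Ω : Type*} [MeasurableSpace Ω] (P : Measure Ω)
    (Y X : Ω → Rd d) (f : Rd d → Rd d) : Prop :=
  Integrable Y P ∧ Measurable f ∧
    (fun w => f (X w)) =ᵐ[P] P[Y | MeasurableSpace.comap X inferInstance]

/-- `u ∈ C⁰(S; C^p(R^d; F))` for the topology of locally uniform convergence of derivatives:
every `u(t, ·)` is `C^p`, and its spatial derivatives up to order `p` are jointly continuous. -/
def MemC0Cp {d : ℕ} {F : Type*} [NormedAddCommGroup F] [NormedSpace ℝ F]
    (S : Set ℝ) (p : ℕ) (u : ℝ → Rd d → F) : Prop :=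
  (∀ t ∈ S, ContDiff ℝ p (u t)) ∧
    ∀ n ≤ p, ContinuousOn (fun q : ℝ × Rd d => iteratedFDeriv ℝ n (u q.1) q.2) (S ×ˢ univ)

/-- `u ∈ C¹(S; C^p(R^d; F))`: both `u` and its time derivative lie in `C⁰(S; C^p(R^d; F))`. -/
def MemC1Cp {d : ℕ} {F : Type*} [NormedAddCommGroup F] [NormedSpace ℝ F]
    (S : Set ℝ) (p : ℕ) (u : ℝ → Rd d → F) : Prop :=
  MemC0Cp S p u ∧ MemC0Cp S p (fun t x => derivWithin (fun s => u s x) S t) ∧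
    ∀ x, DifferentiableOn ℝ (fun s => u s x) S

/-- The divergence of a vector field on `R^d`. -/
def divergence {d : ℕ} (v : Rd d → Rd d) (x : Rd d) : ℝ :=
  ∑ i : Fin d, fderiv ℝ v x (EuclideanSpace.single i 1) i

end

end Interpolant

/-! Inside `(0,1)` the Gaussian term smooths everything. Write `g` for the standard Gaussian density
and `y = (x - I) / γ`, the value of `z` forced by `x_t = x`. The law of `x_t` has the density `ρ =
γ^(-d) E[g(y)]`, and the velocity carries the flux `j = γ^(-d) E[g(y) (∂ₜI + γ' y)]`. Space
derivatives fall only on `g(y)` and `g(y) y`, whose derivatives of every order are bounded, so a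
single integrable bound on `∂ₜI` makes `ρ` and `j` smooth in `x`, continuously in `t`
(`IsRegularPath.memC0Cp_kernelIntegral`). That bound is `C₁ |x₀ - x₁|`, integrable because `x₁ - x₀
= ∫ ∂ₜI dt`. For fixed `(x₀, x₁)` the Gaussian kernel solves the transport equation with velocity
`∂ₜI + γ' y`; averaging gives `∂ₜρ + div j = 0` (`hasDerivAt_smoothedDensity`). By Fubini, `b = j /
ρ` is the conditional expectation (`IsDifferentiablePath.isCondExpGiven`).

At the endpoints the kernel degenerates and `γ'` may blow up, but `γ γ' = (γ²)' / 2` extends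
continuously. Stein's identity `E[ψ(x_t) · z] = γ E[div ψ(x_t)]` rewrites the flux tested against
`ψ` as `fluxPairing`, which contains only `∂ₜI` and `(γ²)'` and is continuous on `[0,1]`. At `t = 0,
1`, integrating `div ψ` by parts against the regular endpoint density produces the term `-(1/2)
(γ²)' ∇ log ρ`, so the prescribed endpoint velocity represents the same pairing
(`exists_endpoint_velocity`). Weak continuity of the flux follows, and so does the weak equation
with one-sided derivatives, since a continuous function whose interior derivative extends
continuously is differentiable up to the boundary.

Square integrability is conditional Jensen, with finite Fisher information controlling the extra
endpoint term. -/

namespace Interpolant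

/-! ### Calculus of functions continuous in time and `C^p` in space -/

section FunctionSpaces

variable {d : ℕ} {F F₁ F₂ : Type} [NormedAddCommGroup F] [NormedSpace ℝ F]
  [NormedAddCommGroup F₁] [NormedSpace ℝ F₁] [NormedAddCommGroup F₂] [NormedSpace ℝ F₂]
  {S : Set ℝ} {p : ℕ}

lemma MemC0Cp.mono {u : ℝ → Rd d → F} {q : ℕ} (hu : MemC0Cp S q u) (hpq : p ≤ q) :
    MemC0Cp S p u :=
  ⟨fun t ht => (hu.1 t ht).of_le (by exact_mod_cast hpq), fun n hn => hu.2 n (hn.trans hpq)⟩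

lemma MemC0Cp.congr {u v : ℝ → Rd d → F} (hu : MemC0Cp S p u) (h : ∀ t ∈ S, v t = u t) :
    MemC0Cp S p v :=
  ⟨fun t ht => by rw [h t ht]; exact hu.1 t ht,
    fun n hn => (hu.2 n hn).congr fun q hq => by simp only [h q.1 hq.1]⟩

lemma continuousOn_iteratedFDeriv_zero_iff {u : ℝ → Rd d → F} :
    ContinuousOn (fun q : ℝ × Rd d => iteratedFDeriv ℝ 0 (u q.1) q.2) (S ×ˢ univ) ↔
      ContinuousOn (fun q : ℝ × Rd d => u q.1 q.2) (S ×ˢ univ) := by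
  simp only [iteratedFDeriv_zero_eq_comp, Function.comp_apply]
  exact (LinearIsometryEquiv.comp_continuousOn_iff
    (continuousMultilinearCurryFin0 ℝ (Rd d) F).symm)

lemma continuousOn_iteratedFDeriv_succ_iff {u : ℝ → Rd d → F} {n : ℕ} :
    ContinuousOn (fun q : ℝ × Rd d => iteratedFDeriv ℝ (n + 1) (u q.1) q.2) (S ×ˢ univ) ↔
      ContinuousOn (fun q : ℝ × Rd d => iteratedFDeriv ℝ n (fderiv ℝ (u q.1)) q.2)
        (S ×ˢ univ) := by
  simp only [iteratedFDeriv_succ_eq_comp_right, Function.comp_apply]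
  exact (LinearIsometryEquiv.comp_continuousOn_iff
    (continuousMultilinearCurryRightEquiv' ℝ n (Rd d) F).symm)

lemma memC0Cp_zero_iff {u : ℝ → Rd d → F} :
    MemC0Cp S 0 u ↔ ContinuousOn (fun q : ℝ × Rd d => u q.1 q.2) (S ×ˢ univ) := by
  rw [← continuousOn_iteratedFDeriv_zero_iff]
  refine ⟨fun h => h.2 0 le_rfl, fun h => ⟨fun t ht => ?_, fun n hn => ?_⟩⟩
  · rw [continuousOn_iteratedFDeriv_zero_iff] at h
    rw [Nat.cast_zero, contDiff_zero, ← continuousOn_univ]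
    exact h.comp (f := fun x => (t, x)) (by fun_prop) fun x _ => ⟨ht, mem_univ _⟩
  · obtain rfl : n = 0 := by omega
    exact h

/-- The engine of the inductions on `p` below: it trades iterated derivatives for one Fréchet
derivative, at the price of changing the target space. -/
lemma memC0Cp_succ_iff {u : ℝ → Rd d → F} :
    MemC0Cp S (p + 1) u ↔ (∀ t ∈ S, Differentiable ℝ (u t)) ∧
      ContinuousOn (fun q : ℝ × Rd d => u q.1 q.2) (S ×ˢ univ) ∧
      MemC0Cp S p (fun t => fderiv ℝ (u t)) := by
  constructor
  · intro h
    refine ⟨fun t ht => (h.1 t ht).differentiable (by simp),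
      continuousOn_iteratedFDeriv_zero_iff.1 (h.2 0 (by omega)), fun t ht => ?_, fun n hn => ?_⟩
    · exact (h.1 t ht).fderiv_right (by simp)
    · exact continuousOn_iteratedFDeriv_succ_iff.1 (h.2 (n + 1) (by omega))
  · rintro ⟨hd, hc, h⟩
    refine ⟨fun t ht => ?_, fun n hn => ?_⟩
    · exact_mod_cast contDiff_succ_iff_fderiv.2 ⟨hd t ht, by simp, h.1 t ht⟩
    · cases n with
      | zero => exact continuousOn_iteratedFDeriv_zero_iff.2 hc
      | succ n => exact continuousOn_iteratedFDeriv_succ_iff.2 (h.2 n (by omega))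

lemma MemC0Cp.add {u v : ℝ → Rd d → F} (hu : MemC0Cp S p u) (hv : MemC0Cp S p v) :
    MemC0Cp S p (fun t x => u t x + v t x) := by
  refine ⟨fun t ht => (hu.1 t ht).add (hv.1 t ht), fun n hn => ?_⟩
  refine ((hu.2 n hn).add (hv.2 n hn)).congr fun q hq => ?_
  exact iteratedFDeriv_add_apply ((hu.1 q.1 hq.1).of_le (by exact_mod_cast hn)).contDiffAt
    ((hv.1 q.1 hq.1).of_le (by exact_mod_cast hn)).contDiffAt

lemma MemC0Cp.clm_comp {u : ℝ → Rd d → F} (L : F →L[ℝ] F₁) (hu : MemC0Cp S p u) :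
    MemC0Cp S p (fun t x => L (u t x)) := by
  refine ⟨fun t ht => L.contDiff.comp (hu.1 t ht), fun n hn => ?_⟩
  refine ((ContinuousLinearMap.compContinuousMultilinearMapL ℝ (fun _ : Fin n => Rd d) F F₁
    L).continuous.comp_continuousOn (hu.2 n hn)).congr fun q hq => ?_
  exact L.iteratedFDeriv_comp_left (hu.1 q.1 hq.1).contDiffAt (by exact_mod_cast hn)

lemma memC0Cp_of_continuousOn {f : ℝ → F} (hf : ContinuousOn f S) :
    MemC0Cp (d := d) S p (fun t _ => f t) := by
  have h0 : ContinuousOn (fun q : ℝ × Rd d => f q.1) (S ×ˢ univ) :=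
    hf.comp continuousOn_fst fun q hq => hq.1
  cases p with
  | zero => exact memC0Cp_zero_iff.2 h0
  | succ p =>
    refine memC0Cp_succ_iff.2 ⟨fun t _ => differentiable_const _, h0, ?_⟩
    simp only [fderiv_fun_const, Pi.zero_def]
    refine ⟨fun t _ => contDiff_const, fun n _ => ?_⟩
    simp only [iteratedFDeriv_fun_zero, Pi.zero_apply]
    exact continuousOn_const

/-- The product rule expresses the derivative of `B(u, v)` through two bilinear maps of the same
kind, `precompR` and `precompL`. The induction therefore has to run over all target spaces at once.
-/
lemma MemC0Cp.bilin {F₁ F₂ F : Type} [NormedAddCommGroup F] [NormedSpace ℝ F]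
    [NormedAddCommGroup F₁] [NormedSpace ℝ F₁] [NormedAddCommGroup F₂] [NormedSpace ℝ F₂]
    (B : F₁ →L[ℝ] F₂ →L[ℝ] F) {u : ℝ → Rd d → F₁} {v : ℝ → Rd d → F₂}
    (hu : MemC0Cp S p u) (hv : MemC0Cp S p v) : MemC0Cp S p (fun t x => B (u t x) (v t x)) := by
  induction p generalizing F₁ F₂ F with
  | zero =>
    rw [memC0Cp_zero_iff] at *
    exact B.isBoundedBilinearMap.continuous.comp_continuousOn (hu.prodMk hv)
  | succ p ih =>
    have hu' := memC0Cp_succ_iff.1 hu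
    have hv' := memC0Cp_succ_iff.1 hv
    refine memC0Cp_succ_iff.2 ⟨fun t ht => ?_, ?_, ?_⟩
    · exact B.isBoundedBilinearMap.differentiable.comp ((hu'.1 t ht).prodMk (hv'.1 t ht))
    · exact B.isBoundedBilinearMap.continuous.comp_continuousOn (hu'.2.1.prodMk hv'.2.1)
    · have h1 := ih (B.precompR (Rd d)) (hu.mono p.le_succ) hv'.2.2
      have h2 := ih (B.precompL (Rd d)) hu'.2.2 (hv.mono p.le_succ)
      refine (h1.add h2).congr fun t ht => ?_
      ext1 x
      exact B.fderiv_of_bilinear (hu'.1 t ht x) (hv'.1 t ht x)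

lemma MemC0Cp.smul {u : ℝ → Rd d → ℝ} {v : ℝ → Rd d → F}
    (hu : MemC0Cp S p u) (hv : MemC0Cp S p v) : MemC0Cp S p (fun t x => u t x • v t x) :=
  MemC0Cp.bilin (ContinuousLinearMap.lsmul ℝ ℝ) hu hv

/-- Induction through `D(1/u) = -(1/u)² Du`: the right side is one order less demanding on `1/u`. -/
lemma MemC0Cp.inv {u : ℝ → Rd d → ℝ} (hu : MemC0Cp S p u)
    (h0 : ∀ t ∈ S, ∀ x, u t x ≠ 0) : MemC0Cp S p (fun t x => (u t x)⁻¹) := by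
  induction p with
  | zero =>
    rw [memC0Cp_zero_iff] at *
    exact hu.inv₀ fun q hq => h0 q.1 hq.1 q.2
  | succ p ih =>
    have hu' := memC0Cp_succ_iff.1 hu
    have hi := ih (hu.mono p.le_succ)
    refine memC0Cp_succ_iff.2 ⟨fun t ht => (hu'.1 t ht).inv (h0 t ht),
      hu'.2.1.inv₀ fun q hq => h0 q.1 hq.1 q.2, ?_⟩
    refine ((hi.smul hi).smul (hu'.2.2.clm_comp (-ContinuousLinearMap.id ℝ _))).congr
      fun t ht => ?_
    ext1 x
    refine ((hasDerivAt_inv (h0 t ht x)).comp_hasFDerivAt x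
      (hu'.1 t ht x).hasFDerivAt).fderiv.trans ?_
    ext v
    simp [sq]

end FunctionSpaces

end Interpolant

namespace Interpolant

noncomputable section

/-! ### The Gaussian density and its products with functions of temperate growth -/

section Gaussian

variable {d : ℕ}

/-- The density of the standard Gaussian measure on `R^d`. -/
def gaussianDensity (y : Rd d) : ℝ :=
  (2 * Real.pi) ^ (-(d / 2 : ℝ)) * Real.exp (-(1 / 2) * ‖y‖ ^ 2)

lemma gaussianDensity_pos (y : Rd d) : 0 < gaussianDensity y := by
  unfold gaussianDensity; positivity

lemma contDiff_gaussianDensity : ContDiff ℝ ∞ (gaussianDensity (d := d)) :=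
  contDiff_const.mul (Real.contDiff_exp.comp (contDiff_const.mul (contDiff_norm_sq ℝ)))

lemma continuous_gaussianDensity : Continuous (gaussianDensity (d := d)) :=
  contDiff_gaussianDensity.continuous

lemma hasFDerivAt_gaussianDensity (y : Rd d) :
    HasFDerivAt gaussianDensity (-gaussianDensity y • innerSL ℝ y) y := by
  have h := (((hasStrictFDerivAt_norm_sq y).hasFDerivAt.const_mul (-(1 / 2) : ℝ)).exp).const_mul
    ((2 * Real.pi) ^ (-(d / 2 : ℝ)))
  refine h.congr_fderiv ?_
  ext v
  simp [gaussianDensity]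
  ring

lemma integrable_exp_neg_norm_sq :
    Integrable fun y : Rd d => Real.exp (-(1 / 2) * ‖y‖ ^ 2) := by
  have h := (GaussianFourier.integrable_cexp_neg_mul_sq_norm_add (V := Rd d)
    (b := (1 / 2 : ℂ)) (by norm_num) 0 0).norm
  refine h.congr (ae_of_all _ fun y => ?_)
  simp only [Complex.norm_exp, zero_mul, add_zero]
  congr 1
  norm_cast
  simp
  norm_cast

lemma integrable_gaussianDensity : Integrable (gaussianDensity (d := d)) :=
  integrable_exp_neg_norm_sq.const_mul _

/-- Finite measures are determined by their characteristic functions. The Gaussian Fourier integral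
with parameter `1/2` contributes the factor `(2π)^(d/2)`, which the normalisation cancels. -/
lemma stdGaussian_eq_densityMeasure : stdGaussian (Rd d) = densityMeasure gaussianDensity := by
  have hfin : IsFiniteMeasure (densityMeasure (gaussianDensity (d := d))) :=
    isFiniteMeasure_withDensity_ofReal integrable_gaussianDensity.2
  refine Measure.ext_of_charFun ?_
  ext t
  rw [charFun_stdGaussian, charFun_apply, densityMeasure,
    integral_withDensity_eq_integral_toReal_smul
      (continuous_gaussianDensity.measurable.ennreal_ofReal) (ae_of_all _ fun _ => by simp)]
  have h := GaussianFourier.integral_cexp_neg_mul_sq_norm_add (V := Rd d)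
    (b := (1 / 2 : ℂ)) (by norm_num) Complex.I t
  have h2 : ∀ y : Rd d, (ENNReal.ofReal (gaussianDensity y)).toReal •
      Complex.exp (inner ℝ y t * Complex.I) = ((2 * Real.pi) ^ (-(d / 2 : ℝ)) : ℝ) *
        Complex.exp (-(1 / 2 : ℂ) * ‖y‖ ^ 2 + Complex.I * inner ℝ t y) := by
    intro y
    rw [ENNReal.toReal_ofReal (gaussianDensity_pos y).le, gaussianDensity, Complex.real_smul,
      Complex.exp_add, real_inner_comm y t]
    push_cast
    ring_nf
  simp_rw [h2]
  rw [integral_const_mul, h, ← mul_assoc]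
  have h3 : (((2 * Real.pi) ^ (-(d / 2 : ℝ)) : ℝ) : ℂ) *
      ((Real.pi : ℂ) / (1 / 2)) ^ ((Module.finrank ℝ (Rd d) : ℂ) / 2) = 1 := by
    have : ((Real.pi : ℂ) / (1 / 2)) ^ ((Module.finrank ℝ (Rd d) : ℂ) / 2) =
        (((2 * Real.pi) ^ (d / 2 : ℝ) : ℝ) : ℂ) := by
      rw [Complex.ofReal_cpow (by positivity)]
      simp
      ring_nf
    rw [this, ← Complex.ofReal_mul, ← Real.rpow_add (by positivity)]
    simp
  rw [h3, one_mul]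
  congr 1
  simp
  ring

lemma integral_stdGaussian {F : Type*} [NormedAddCommGroup F] [NormedSpace ℝ F]
    (f : Rd d → F) : ∫ z, f z ∂stdGaussian (Rd d) = ∫ z, gaussianDensity z • f z := by
  rw [stdGaussian_eq_densityMeasure, densityMeasure, integral_withDensity_eq_integral_toReal_smul
      (continuous_gaussianDensity.measurable.ennreal_ofReal) (ae_of_all _ fun _ => by simp)]
  simp_rw [ENNReal.toReal_ofReal (gaussianDensity_pos _).le]

lemma exists_one_add_pow_mul_gaussianDensity_le (k : ℕ) :
    ∃ C : ℝ, ∀ y : Rd d, (1 + ‖y‖) ^ k * gaussianDensity y ≤ C := by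
  -- With `r = ‖y‖`: `(1 + r)^k ≤ k! exp(1 + r)`, and `1 + r - r²/2 = 3/2 - (r - 1)²/2 ≤ 3/2`.
  refine ⟨(2 * Real.pi) ^ (-(d / 2 : ℝ)) * (k.factorial * Real.exp (3 / 2)), fun y => ?_⟩
  have h1 := Real.pow_div_factorial_le_exp (1 + ‖y‖) (by positivity) k
  rw [div_le_iff₀ (by positivity)] at h1
  have h2 : Real.exp (1 + ‖y‖) * Real.exp (-(1 / 2) * ‖y‖ ^ 2) ≤ Real.exp (3 / 2) := by
    rw [← Real.exp_add, Real.exp_le_exp]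
    nlinarith [sq_nonneg (‖y‖ - 1)]
  calc (1 + ‖y‖) ^ k * gaussianDensity y
      = (2 * Real.pi) ^ (-(d / 2 : ℝ)) * ((1 + ‖y‖) ^ k * Real.exp (-(1 / 2) * ‖y‖ ^ 2)) := by
        unfold gaussianDensity; ring
    _ ≤ (2 * Real.pi) ^ (-(d / 2 : ℝ)) * (Real.exp (1 + ‖y‖) * k.factorial *
          Real.exp (-(1 / 2) * ‖y‖ ^ 2)) := by gcongr
    _ = (2 * Real.pi) ^ (-(d / 2 : ℝ)) * (k.factorial * (Real.exp (1 + ‖y‖) *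
          Real.exp (-(1 / 2) * ‖y‖ ^ 2))) := by ring
    _ ≤ _ := by gcongr

/-- Functions of temperate growth multiplied with the Gaussian density. -/
def IsGaussianTimesTemperate {F : Type*} [NormedAddCommGroup F] [NormedSpace ℝ F]
    (Φ : Rd d → F) : Prop :=
  ∃ T : Rd d → F, T.HasTemperateGrowth ∧ Φ = fun y => gaussianDensity y • T y

namespace IsGaussianTimesTemperate

variable {F : Type*} [NormedAddCommGroup F] [NormedSpace ℝ F] {Φ : Rd d → F}

lemma contDiff (h : IsGaussianTimesTemperate Φ) : ContDiff ℝ ∞ Φ := by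
  obtain ⟨T, hT, rfl⟩ := h
  exact contDiff_gaussianDensity.smul hT.1

lemma exists_norm_le (h : IsGaussianTimesTemperate Φ) : ∃ C : ℝ, ∀ y, ‖Φ y‖ ≤ C := by
  obtain ⟨T, hT, rfl⟩ := h
  obtain ⟨k, C, hC⟩ := hT.2 0
  obtain ⟨C', hC'⟩ := exists_one_add_pow_mul_gaussianDensity_le (d := d) k
  have hC0 : 0 ≤ C := by simpa using (norm_nonneg _).trans (hC 0)
  refine ⟨C * C', fun y => ?_⟩
  have h0 := hC y
  rw [norm_iteratedFDeriv_zero] at h0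
  rw [norm_smul, Real.norm_of_nonneg (gaussianDensity_pos y).le]
  calc gaussianDensity y * ‖T y‖ ≤ gaussianDensity y * (C * (1 + ‖y‖) ^ k) := by
        gcongr; exact (gaussianDensity_pos y).le
    _ = C * ((1 + ‖y‖) ^ k * gaussianDensity y) := by ring
    _ ≤ C * C' := by gcongr; exact hC' y

/-- Since `Dg = -g ⟨y, ·⟩`, one has `D(g T) = g (DT - ⟨y, ·⟩ T)`. Closure under differentiation,
together with boundedness, is the reason for introducing this class. -/
lemma fderiv (h : IsGaussianTimesTemperate Φ) : IsGaussianTimesTemperate (fderiv ℝ Φ) := by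
  obtain ⟨T, hT, rfl⟩ := h
  have hT' : Function.HasTemperateGrowth (_root_.fderiv ℝ T) := by
    refine ⟨hT.1.fderiv_right (by simp), fun n => ?_⟩
    obtain ⟨k, C, hC⟩ := hT.2 (n + 1)
    exact ⟨k, C, fun x => by simpa only [norm_iteratedFDeriv_fderiv] using hC x⟩
  refine ⟨fun y => _root_.fderiv ℝ T y - (ContinuousLinearMap.smulRightL ℝ (Rd d) F)
    (innerSL ℝ y) (T y), ?_, ?_⟩
  · exact hT'.sub (ContinuousLinearMap.bilinear_hasTemperateGrowth _
      (innerSL ℝ (E := Rd d)).hasTemperateGrowth hT)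
  · ext1 y
    refine ((hasFDerivAt_gaussianDensity y).smul
      (hT.1.differentiable (by simp) y).hasFDerivAt).fderiv.trans ?_
    ext v
    simp [smul_smul, sub_eq_add_neg]

end IsGaussianTimesTemperate

lemma isGaussianTimesTemperate_gaussianDensity :
    IsGaussianTimesTemperate (gaussianDensity (d := d)) :=
  ⟨fun _ => 1, .const 1, by simp⟩

lemma isGaussianTimesTemperate_gaussianDensity_smul_id :
    IsGaussianTimesTemperate fun y : Rd d => gaussianDensity y • y :=
  ⟨fun y => y, .id', rfl⟩

end Gaussian

/-! ### Regularity of averages of rescaled Gaussian kernels -/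

section KernelIntegral

variable {d : ℕ} {Q : Type*} [MeasurableSpace Q] {ν : Measure Q} {S : Set ℝ}
  {X : ℝ → Q → Rd d} {γ : ℝ → ℝ} {h : Q → ℝ}

/-- The average of `B (w t q) (Φ ((x - X t q) / γ t))` over `q`. -/
def kernelIntegral {F₁ F₂ F : Type} [NormedAddCommGroup F₁] [NormedSpace ℝ F₁]
    [NormedAddCommGroup F₂] [NormedSpace ℝ F₂] [NormedAddCommGroup F] [NormedSpace ℝ F]
    (ν : Measure Q) (X : ℝ → Q → Rd d) (γ : ℝ → ℝ) (B : F₁ →L[ℝ] F₂ →L[ℝ] F)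
    (w : ℝ → Q → F₁) (Φ : Rd d → F₂) (t : ℝ) (x : Rd d) : F :=
  ∫ q, B (w t q) (Φ ((γ t)⁻¹ • (x - X t q))) ∂ν

/-- The regularity in `t` and `q` of a path `X` and a scale `γ`. -/
structure IsRegularPath (S : Set ℝ) (X : ℝ → Q → Rd d) (γ : ℝ → ℝ) : Prop where
  scale_pos : ∀ t ∈ S, 0 < γ t
  continuousOn_scale : ContinuousOn γ S
  measurable_path : ∀ t ∈ S, Measurable (X t)
  continuousOn_path : ∀ q, ContinuousOn (X · q) S

/-- A weight that is continuous in `t`, measurable in `q` and dominated by `h`. -/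
structure IsDominatedWeight {F₁ : Type} [NormedAddCommGroup F₁] (S : Set ℝ) (w : ℝ → Q → F₁)
    (h : Q → ℝ) : Prop where
  stronglyMeasurable : ∀ t ∈ S, StronglyMeasurable (w t)
  continuousOn : ∀ q, ContinuousOn (w · q) S
  norm_le : ∀ t ∈ S, ∀ q, ‖w t q‖ ≤ h q

variable {F₁ F₂ F : Type} [NormedAddCommGroup F₁] [NormedSpace ℝ F₁]
  [NormedAddCommGroup F₂] [NormedSpace ℝ F₂] [NormedAddCommGroup F] [NormedSpace ℝ F]
  {B : F₁ →L[ℝ] F₂ →L[ℝ] F} {w : ℝ → Q → F₁} {Φ : Rd d → F₂}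

lemma IsRegularPath.aestronglyMeasurable_kernel (hX : IsRegularPath S X γ)
    (hw : IsDominatedWeight S w h) (B : F₁ →L[ℝ] F₂ →L[ℝ] F) (hΦ : Continuous Φ)
    {t : ℝ} (ht : t ∈ S) (x : Rd d) :
    AEStronglyMeasurable (fun q => B (w t q) (Φ ((γ t)⁻¹ • (x - X t q)))) ν := by
  have h1 : StronglyMeasurable fun q => (γ t)⁻¹ • (x - X t q) :=
    have hm := hX.measurable_path t ht
    Measurable.stronglyMeasurable (by fun_prop)
  exact (B.isBoundedBilinearMap.continuous.comp_stronglyMeasurable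
    ((hw.stronglyMeasurable t ht).prodMk (hΦ.comp_stronglyMeasurable h1))).aestronglyMeasurable

/-- Boundedness of `Φ` makes the bound independent of `t` and of the kernel's argument, so one
multiple of `h` dominates in every limit taken under the integral. -/
lemma IsDominatedWeight.exists_norm_kernel_le (hw : IsDominatedWeight S w h)
    (B : F₁ →L[ℝ] F₂ →L[ℝ] F) (hΦ : IsGaussianTimesTemperate Φ) :
    ∃ K : ℝ, ∀ t ∈ S, ∀ q, ∀ y : Rd d, ‖B (w t q) (Φ y)‖ ≤ K * h q := by
  obtain ⟨C, hC⟩ := hΦ.exists_norm_le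
  refine ⟨‖B‖ * C, fun t ht q y => (B.le_opNorm₂ _ _).trans ?_⟩
  have h1 : 0 ≤ C := (norm_nonneg _).trans (hC y)
  calc ‖B‖ * ‖w t q‖ * ‖Φ y‖ ≤ ‖B‖ * h q * C := by
        gcongr
        exacts [mul_nonneg (norm_nonneg B) ((norm_nonneg _).trans (hw.norm_le t ht q)),
          hw.norm_le t ht q, hC y]
    _ = ‖B‖ * C * h q := by ring

lemma IsRegularPath.integrable_kernel (hX : IsRegularPath S X γ)
    (hw : IsDominatedWeight S w h) (hh : Integrable h ν) (B : F₁ →L[ℝ] F₂ →L[ℝ] F)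
    (hΦ : IsGaussianTimesTemperate Φ) {t : ℝ} (ht : t ∈ S) (x : Rd d) :
    Integrable (fun q => B (w t q) (Φ ((γ t)⁻¹ • (x - X t q)))) ν := by
  obtain ⟨K, hK⟩ := hw.exists_norm_kernel_le B hΦ
  exact (hh.const_mul K).mono'
    (hX.aestronglyMeasurable_kernel hw B hΦ.contDiff.continuous ht x)
    (ae_of_all _ fun q => hK t ht q _)

lemma IsRegularPath.continuousOn_kernelIntegral (hX : IsRegularPath S X γ)
    (hw : IsDominatedWeight S w h) (hh : Integrable h ν) (B : F₁ →L[ℝ] F₂ →L[ℝ] F)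
    (hΦ : IsGaussianTimesTemperate Φ) :
    ContinuousOn (fun a : ℝ × Rd d => kernelIntegral ν X γ B w Φ a.1 a.2) (S ×ˢ univ) := by
  obtain ⟨K, hK⟩ := hw.exists_norm_kernel_le B hΦ
  refine continuousOn_of_dominated (bound := fun q => K * h q)
    (fun a ha => hX.aestronglyMeasurable_kernel hw B hΦ.contDiff.continuous ha.1 a.2)
    (fun a ha => ae_of_all _ fun q => hK a.1 ha.1 q _)
    (hh.const_mul K) (ae_of_all _ fun q => ?_)
  have hfst : ∀ {E : Type} [TopologicalSpace E] {f : ℝ → E}, ContinuousOn f S →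
      ContinuousOn (fun a : ℝ × Rd d => f a.1) (S ×ˢ univ) :=
    fun hf => hf.comp continuousOn_fst fun a ha => ha.1
  refine B.isBoundedBilinearMap.continuous.comp_continuousOn
    ((hfst (hw.continuousOn q)).prodMk (hΦ.contDiff.continuous.comp_continuousOn ?_))
  exact ((hfst hX.continuousOn_scale).inv₀ fun a ha => (hX.scale_pos a.1 ha.1).ne').smul
    (continuousOn_snd.sub (hfst (hX.continuousOn_path q)))

/-- The derivative hits only `Φ`, so the result is again a kernel integral, with `DΦ` for `Φ` and an
extra factor `1/γ`. No regularity of `w` or `X` in `q` beyond measurability enters. -/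
lemma IsRegularPath.hasFDerivAt_kernelIntegral (hX : IsRegularPath S X γ)
    (hw : IsDominatedWeight S w h) (hh : Integrable h ν) (B : F₁ →L[ℝ] F₂ →L[ℝ] F)
    (hΦ : IsGaussianTimesTemperate Φ) {t : ℝ} (ht : t ∈ S) (x : Rd d) :
    HasFDerivAt (kernelIntegral ν X γ B w Φ t)
      ((γ t)⁻¹ • kernelIntegral ν X γ (B.precompR (Rd d)) w (fderiv ℝ Φ) t x) x := by
  obtain ⟨K, hK⟩ := hw.exists_norm_kernel_le (B.precompR (Rd d)) hΦ.fderiv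
  rw [kernelIntegral, ← integral_smul]
  refine hasFDerivAt_integral_of_dominated_of_fderiv_le (s := univ)
    (bound := fun q => ‖(γ t)⁻¹‖ * (K * h q))
    (F' := fun x q => (γ t)⁻¹ • B.precompR (Rd d) (w t q)
      (fderiv ℝ Φ ((γ t)⁻¹ • (x - X t q)))) Filter.univ_mem
    (Filter.Eventually.of_forall fun y =>
      hX.aestronglyMeasurable_kernel hw B hΦ.contDiff.continuous ht y)
    (hX.integrable_kernel hw hh B hΦ ht x)
    ((hX.aestronglyMeasurable_kernel hw (B.precompR (Rd d)) hΦ.fderiv.contDiff.continuous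
      ht x).fun_const_smul _)
    (ae_of_all _ fun q y _ => ?_)
    ((hh.const_mul K).const_mul _)
    (ae_of_all _ fun q y _ => ?_)
  · rw [norm_smul]
    exact mul_le_mul_of_nonneg_left (hK t ht q _) (norm_nonneg _)
  · have h1 : HasFDerivAt (fun y => (γ t)⁻¹ • (y - X t q))
        ((γ t)⁻¹ • ContinuousLinearMap.id ℝ (Rd d)) y :=
      ((hasFDerivAt_id y).sub_const _).fun_const_smul _
    have h2 := (B (w t q)).hasFDerivAt.comp y
      ((hΦ.contDiff.differentiable (by simp) _).hasFDerivAt.comp y h1)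
    refine h2.congr_fderiv ?_
    ext v
    simp

lemma IsRegularPath.memC0Cp_kernelIntegral {F₁ F₂ F : Type} [NormedAddCommGroup F₁]
    [NormedSpace ℝ F₁] [NormedAddCommGroup F₂] [NormedSpace ℝ F₂] [NormedAddCommGroup F]
    [NormedSpace ℝ F] {w : ℝ → Q → F₁} {Φ : Rd d → F₂} (hX : IsRegularPath S X γ)
    (hw : IsDominatedWeight S w h) (hh : Integrable h ν) (B : F₁ →L[ℝ] F₂ →L[ℝ] F)
    (hΦ : IsGaussianTimesTemperate Φ) (p : ℕ) :
    MemC0Cp S p (kernelIntegral ν X γ B w Φ) := by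
  induction p generalizing F₂ F with
  | zero => exact memC0Cp_zero_iff.2 (hX.continuousOn_kernelIntegral hw hh B hΦ)
  | succ p ih =>
    refine memC0Cp_succ_iff.2 ⟨fun t ht x =>
      (hX.hasFDerivAt_kernelIntegral hw hh B hΦ ht x).differentiableAt,
      hX.continuousOn_kernelIntegral hw hh B hΦ, ?_⟩
    refine ((memC0Cp_of_continuousOn (hX.continuousOn_scale.inv₀
      fun t ht => (hX.scale_pos t ht).ne')).smul (ih (B.precompR (Rd d)) hΦ.fderiv)).congr
      fun t ht => ?_
    ext1 x
    exact (hX.hasFDerivAt_kernelIntegral hw hh B hΦ ht x).fderiv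

end KernelIntegral

/-! ### Smoothed density and flux: regularity in space -/

section Smoothing

variable {d : ℕ} {Q : Type*} [MeasurableSpace Q] {ν : Measure Q} {S : Set ℝ}
  {X V : ℝ → Q → Rd d} {γ γ' : ℝ → ℝ} {h : Q → ℝ}

/-- The trace of an endomorphism of `R^d`, as a continuous linear map. -/
def traceCLM (d : ℕ) : (Rd d →L[ℝ] Rd d) →L[ℝ] ℝ :=
  ∑ i, (EuclideanSpace.proj i).comp (ContinuousLinearMap.apply ℝ (Rd d) (EuclideanSpace.single i 1))

lemma traceCLM_apply (L : Rd d →L[ℝ] Rd d) :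
    traceCLM d L = ∑ i, L (EuclideanSpace.single i 1) i := by
  simp [traceCLM]

lemma divergence_eq (v : Rd d → Rd d) (x : Rd d) : divergence v x = traceCLM d (fderiv ℝ v x) := by
  rw [traceCLM_apply, divergence]

lemma sum_apply_single_mul (L : Rd d →L[ℝ] ℝ) (v : Rd d) :
    ∑ i, L (EuclideanSpace.single i 1) * v i = L v := by
  conv_rhs => rw [← (EuclideanSpace.basisFun (Fin d) ℝ).sum_repr v]
  simp [mul_comm]

lemma traceCLM_smulRight (L : Rd d →L[ℝ] ℝ) (v : Rd d) : traceCLM d (L.smulRight v) = L v := by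
  rw [traceCLM_apply, ← sum_apply_single_mul]
  simp

lemma traceCLM_id : traceCLM d (ContinuousLinearMap.id ℝ (Rd d)) = d := by
  rw [traceCLM_apply]
  simp

/-- The density of `X t q + γ t • z` for `q ∼ ν` and an independent standard Gaussian `z`. -/
def smoothedDensity (ν : Measure Q) (X : ℝ → Q → Rd d) (γ : ℝ → ℝ) (t : ℝ) (x : Rd d) : ℝ :=
  (γ t ^ d)⁻¹ * ∫ q, gaussianDensity ((γ t)⁻¹ • (x - X t q)) ∂ν

/-- The density of the vector measure `E[(V t q + γ' t • z) 1_{X t q + γ t • z ∈ dx}]`. -/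
def smoothedFlux (ν : Measure Q) (X V : ℝ → Q → Rd d) (γ γ' : ℝ → ℝ) (t : ℝ) (x : Rd d) : Rd d :=
  (γ t ^ d)⁻¹ • ∫ q, gaussianDensity ((γ t)⁻¹ • (x - X t q)) •
    (V t q + γ' t • (γ t)⁻¹ • (x - X t q)) ∂ν

/-- A path `X` with velocity `V` dominated by `h`, and a positive scale `γ` with derivative
`γ'`, on an open set of times. -/
structure IsDifferentiablePath (S : Set ℝ) (X V : ℝ → Q → Rd d) (γ γ' : ℝ → ℝ) (h : Q → ℝ) :
    Prop where
  isOpen : IsOpen S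
  scale_pos : ∀ t ∈ S, 0 < γ t
  hasDerivAt_scale : ∀ t ∈ S, HasDerivAt γ (γ' t) t
  continuousOn_scale_deriv : ContinuousOn γ' S
  measurable_path : ∀ t ∈ S, Measurable (X t)
  hasDerivAt_path : ∀ t ∈ S, ∀ q, HasDerivAt (X · q) (V t q) t
  weight : IsDominatedWeight S V h

lemma IsDifferentiablePath.isRegularPath (hX : IsDifferentiablePath S X V γ γ' h) :
    IsRegularPath S X γ where
  scale_pos := hX.scale_pos
  continuousOn_scale t ht := (hX.hasDerivAt_scale t ht).continuousAt.continuousWithinAt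
  measurable_path := hX.measurable_path
  continuousOn_path q t ht := (hX.hasDerivAt_path t ht q).continuousAt.continuousWithinAt

lemma isDominatedWeight_one : IsDominatedWeight S (fun _ (_ : Q) => (1 : ℝ)) (fun _ => 1) where
  stronglyMeasurable _ _ := stronglyMeasurable_const
  continuousOn _ := continuousOn_const
  norm_le _ _ _ := by simp

lemma smoothedDensity_eq (t : ℝ) (x : Rd d) :
    smoothedDensity ν X γ t x = (γ t ^ d)⁻¹ • kernelIntegral ν X γ (ContinuousLinearMap.lsmul ℝ ℝ)
      (fun _ _ => (1 : ℝ)) gaussianDensity t x := by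
  simp [smoothedDensity, kernelIntegral]

lemma IsDifferentiablePath.integrable_gaussianDensity [IsFiniteMeasure ν]
    (hX : IsDifferentiablePath S X V γ γ' h) {t : ℝ} (ht : t ∈ S) (x : Rd d) :
    Integrable (fun q => gaussianDensity ((γ t)⁻¹ • (x - X t q))) ν := by
  simpa using hX.isRegularPath.integrable_kernel (ν := ν) isDominatedWeight_one
    (integrable_const _) (ContinuousLinearMap.lsmul ℝ ℝ)
    isGaussianTimesTemperate_gaussianDensity ht x

/-- The unbounded factor `y` multiplying `γ'` is absorbed into the kernel `g(y) y`, which is still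
bounded; this leaves two kernel integrals with dominated weights. -/
lemma IsDifferentiablePath.smoothedFlux_eq [IsFiniteMeasure ν]
    (hX : IsDifferentiablePath S X V γ γ' h) (hh : Integrable h ν) {t : ℝ} (ht : t ∈ S)
    (x : Rd d) :
    smoothedFlux ν X V γ γ' t x = (γ t ^ d)⁻¹ •
      (kernelIntegral ν X γ (ContinuousLinearMap.lsmul ℝ ℝ).flip V gaussianDensity t x +
      γ' t • kernelIntegral ν X γ (ContinuousLinearMap.lsmul ℝ ℝ) (fun _ _ => (1 : ℝ))
        (fun y => gaussianDensity y • y) t x) := by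
  rw [smoothedFlux, kernelIntegral, kernelIntegral, ← integral_smul (γ' t), ← integral_add]
  · congr 2
    ext1 q
    simp only [smul_add, ContinuousLinearMap.flip_apply, ContinuousLinearMap.lsmul_apply, one_smul]
    rw [smul_comm (γ' t) (gaussianDensity _)]
  · exact hX.isRegularPath.integrable_kernel hX.weight hh _
      isGaussianTimesTemperate_gaussianDensity ht x
  · exact (hX.isRegularPath.integrable_kernel isDominatedWeight_one (integrable_const _) _
      isGaussianTimesTemperate_gaussianDensity_smul_id ht x).fun_smul (γ' t)

lemma IsDifferentiablePath.continuousOn_scale_pow_inv (hX : IsDifferentiablePath S X V γ γ' h)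
    (n : ℕ) : ContinuousOn (fun t => (γ t ^ n)⁻¹) S :=
  (hX.isRegularPath.continuousOn_scale.pow n).inv₀ fun t ht => (pow_pos (hX.scale_pos t ht) n).ne'

lemma IsDifferentiablePath.memC0Cp_smoothedDensity [IsFiniteMeasure ν]
    (hX : IsDifferentiablePath S X V γ γ' h) (p : ℕ) :
    MemC0Cp S p (smoothedDensity ν X γ) := by
  refine ((memC0Cp_of_continuousOn (hX.continuousOn_scale_pow_inv d)).smul
    (hX.isRegularPath.memC0Cp_kernelIntegral (ν := ν) isDominatedWeight_one (integrable_const _)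
      (ContinuousLinearMap.lsmul ℝ ℝ) isGaussianTimesTemperate_gaussianDensity p)).congr
    fun t ht => ?_
  ext1 x
  exact smoothedDensity_eq t x

lemma IsDifferentiablePath.memC0Cp_smoothedFlux [IsFiniteMeasure ν]
    (hX : IsDifferentiablePath S X V γ γ' h) (hh : Integrable h ν) (p : ℕ) :
    MemC0Cp S p (smoothedFlux ν X V γ γ') := by
  have h1 := hX.isRegularPath.memC0Cp_kernelIntegral hX.weight hh
    (ContinuousLinearMap.lsmul ℝ ℝ).flip isGaussianTimesTemperate_gaussianDensity p
  have h2 := hX.isRegularPath.memC0Cp_kernelIntegral (ν := ν) isDominatedWeight_one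
    (integrable_const _) (ContinuousLinearMap.lsmul ℝ ℝ)
    isGaussianTimesTemperate_gaussianDensity_smul_id p
  refine ((memC0Cp_of_continuousOn (hX.continuousOn_scale_pow_inv d)).smul
    (h1.add ((memC0Cp_of_continuousOn hX.continuousOn_scale_deriv).smul h2))).congr
    fun t ht => ?_
  ext1 x
  exact hX.smoothedFlux_eq hh ht x

lemma IsDifferentiablePath.smoothedDensity_pos [IsProbabilityMeasure ν]
    (hX : IsDifferentiablePath S X V γ γ' h) {t : ℝ} (ht : t ∈ S) (x : Rd d) :
    0 < smoothedDensity ν X γ t x := by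
  refine mul_pos (inv_pos.2 (pow_pos (hX.scale_pos t ht) d)) ?_
  rw [integral_pos_iff_support_of_nonneg (fun q => (gaussianDensity_pos _).le)
    (hX.integrable_gaussianDensity ht x)]
  simp [Function.support_eq_univ (fun q => (gaussianDensity_pos _).ne')]

/-- Used twice: to compute the divergence of the flux, and to bound `g(y) (d - ‖y‖²)` by the bounded
derivative of `g(y) y`. -/
lemma traceCLM_fderiv_gaussianDensity_smul_id (y : Rd d) :
    traceCLM d (fderiv ℝ (fun y : Rd d => gaussianDensity y • y) y) =
      gaussianDensity y * (d - ‖y‖ ^ 2) := by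
  have h1 : HasFDerivAt (fun y : Rd d => y) (ContinuousLinearMap.id ℝ (Rd d)) y := hasFDerivAt_id y
  rw [((hasFDerivAt_gaussianDensity y).fun_smul h1).fderiv, map_add, map_smul,
    traceCLM_id, traceCLM_smulRight]
  simp
  ring

/-- The trace passes under the integral; `div (g V) = -g ⟨y, V⟩` for `V` constant in `y`, and the
chain rule supplies one more `1/γ`. The form is chosen to match the time derivative of the kernel.
-/
lemma IsDifferentiablePath.divergence_smoothedFlux [IsFiniteMeasure ν]
    (hX : IsDifferentiablePath S X V γ γ' h) (hh : Integrable h ν) {t : ℝ} (ht : t ∈ S)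
    (x : Rd d) :
    divergence (smoothedFlux ν X V γ γ' t) x = (γ t ^ (d + 1))⁻¹ *
      ∫ q, gaussianDensity ((γ t)⁻¹ • (x - X t q)) *
        (γ' t * (d - ‖(γ t)⁻¹ • (x - X t q)‖ ^ 2) -
          inner ℝ ((γ t)⁻¹ • (x - X t q)) (V t q)) ∂ν := by
  have hR := hX.isRegularPath
  have h1 := hR.hasFDerivAt_kernelIntegral hX.weight hh
    (ContinuousLinearMap.lsmul ℝ ℝ).flip isGaussianTimesTemperate_gaussianDensity ht x
  have h2 := hR.hasFDerivAt_kernelIntegral (ν := ν) isDominatedWeight_one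
    (integrable_const _) (ContinuousLinearMap.lsmul ℝ ℝ)
    isGaussianTimesTemperate_gaussianDensity_smul_id ht x
  have i1 := hR.integrable_kernel hX.weight hh
    ((ContinuousLinearMap.lsmul ℝ ℝ).flip.precompR (Rd d))
    isGaussianTimesTemperate_gaussianDensity.fderiv ht x
  have i2 := hR.integrable_kernel (ν := ν) isDominatedWeight_one (integrable_const _)
    ((ContinuousLinearMap.lsmul ℝ ℝ).precompR (Rd d))
    isGaussianTimesTemperate_gaussianDensity_smul_id.fderiv ht x
  have h3 := (h1.add (h2.const_smul (γ' t))).const_smul (γ t ^ d)⁻¹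
  have h4 : smoothedFlux ν X V γ γ' t = _ := funext fun x => hX.smoothedFlux_eq hh ht x
  rw [divergence_eq, h4]
  refine (congrArg _ h3.fderiv).trans ?_
  rw [map_smul, map_add, map_smul, map_smul, map_smul, kernelIntegral, kernelIntegral,
    ← ContinuousLinearMap.integral_comp_comm _ i1, ← ContinuousLinearMap.integral_comp_comm _ i2,
    smul_comm (γ' t), ← smul_add, ← integral_smul, ← integral_add
      ((traceCLM d).integrable_comp i1) (((traceCLM d).integrable_comp i2).fun_smul (γ' t)), smul_smul,
    ← mul_inv, ← pow_succ, smul_eq_mul]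
  congr 2
  ext1 q
  set y := (γ t)⁻¹ • (x - X t q)
  have e1 : (ContinuousLinearMap.lsmul ℝ ℝ).flip.precompR (Rd d) (V t q)
      (fderiv ℝ gaussianDensity y) = (fderiv ℝ gaussianDensity y).smulRight (V t q) := by
    ext v; simp
  have e2 : (ContinuousLinearMap.lsmul ℝ ℝ).precompR (Rd d) (1 : ℝ)
      (fderiv ℝ (fun y : Rd d => gaussianDensity y • y) y) =
        fderiv ℝ (fun y : Rd d => gaussianDensity y • y) y := by
    ext v; simp
  rw [e1, e2, traceCLM_smulRight, traceCLM_fderiv_gaussianDensity_smul_id,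
    (hasFDerivAt_gaussianDensity y).fderiv]
  simp
  ring

end Smoothing

/-! ### Time derivative of the smoothed density and the transport equation -/

section SmoothingTime

variable {d : ℕ} {Q : Type*} [MeasurableSpace Q] {ν : Measure Q} {S : Set ℝ}
  {X V : ℝ → Q → Rd d} {γ γ' : ℝ → ℝ} {h : Q → ℝ}

lemma hasDerivAt_pow_inv {t g : ℝ} (n : ℕ) (hγ : HasDerivAt γ g t) (h0 : γ t ≠ 0) :
    HasDerivAt (fun s => (γ s ^ n)⁻¹) (-(γ t ^ (n + 1))⁻¹ * (n * g)) t := by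
  refine ((hγ.fun_pow n).fun_inv (pow_ne_zero n h0)).congr_deriv ?_
  cases n with
  | zero => simp
  | succ n =>
    simp only [Nat.add_sub_cancel]
    field_simp
    ring

/-- This is the transport equation for a single `q`: the derivative is minus the divergence of the
kernel times the velocity `V + γ' y`. -/
lemma IsDifferentiablePath.hasDerivAt_kernel (hX : IsDifferentiablePath S X V γ γ' h) {t : ℝ}
    (ht : t ∈ S) (x : Rd d) (q : Q) :
    HasDerivAt (fun s => (γ s ^ d)⁻¹ * gaussianDensity ((γ s)⁻¹ • (x - X s q)))
      (-(γ t ^ (d + 1))⁻¹ * (gaussianDensity ((γ t)⁻¹ • (x - X t q)) *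
        (γ' t * (d - ‖(γ t)⁻¹ • (x - X t q)‖ ^ 2) -
          inner ℝ ((γ t)⁻¹ • (x - X t q)) (V t q)))) t := by
  have h0 : γ t ≠ 0 := (hX.scale_pos t ht).ne'
  have h1 := hasDerivAt_pow_inv d (hX.hasDerivAt_scale t ht) h0
  have h2 := ((hX.hasDerivAt_scale t ht).fun_inv h0).fun_smul
    ((hX.hasDerivAt_path t ht q).const_sub x)
  have h3 := (hasFDerivAt_gaussianDensity ((γ t)⁻¹ • (x - X t q))).comp_hasDerivAt t h2
  refine (h1.fun_mul h3).congr_deriv ?_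
  have h4 : (-γ' t / γ t ^ 2) • (x - X t q) =
      (-γ' t / γ t) • ((γ t)⁻¹ • (x - X t q)) := by
    rw [smul_smul]; congr 1; field_simp
  rw [h4]
  simp only [Function.comp_apply]
  set y := (γ t)⁻¹ • (x - X t q)
  simp only [smul_apply, innerSL_apply_apply, inner_add_right,
    inner_smul_right, real_inner_self_eq_norm_sq, smul_eq_mul, inner_neg_right, pow_succ (γ t) d]
  field_simp
  ring

lemma IsDifferentiablePath.hasDerivAt_smoothedDensity [IsFiniteMeasure ν]
    (hX : IsDifferentiablePath S X V γ γ' h) (hh : Integrable h ν) {t : ℝ} (ht : t ∈ S)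
    (x : Rd d) :
    HasDerivAt (fun s => smoothedDensity ν X γ s x)
      (-divergence (smoothedFlux ν X V γ γ' t) x) t := by
  obtain ⟨C₁, hC₁⟩ := (isGaussianTimesTemperate_gaussianDensity_smul_id (d := d)).exists_norm_le
  obtain ⟨C₂, hC₂⟩ :=
    (isGaussianTimesTemperate_gaussianDensity_smul_id (d := d)).fderiv.exists_norm_le
  have hS : S ∈ nhds t := hX.isOpen.mem_nhds ht
  have hA := ((hX.continuousOn_scale_pow_inv (d + 1)).continuousAt hS).norm.eventually
    (gt_mem_nhds (lt_add_one _))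
  have hΓ := (hX.continuousOn_scale_deriv.continuousAt hS).norm.eventually
    (gt_mem_nhds (lt_add_one _))
  -- By continuity, `A` and `Γ` bound `γ^(-(d+1))` and `γ'` near `t`. The scale is controlled only
  -- locally, since both may blow up at the ends of `S`.
  set A := ‖(γ t ^ (d + 1))⁻¹‖ + 1
  set Γ := ‖γ' t‖ + 1
  have key := hasDerivAt_integral_of_dominated_loc_of_deriv_le (μ := ν)
    (F := fun s q => (γ s ^ d)⁻¹ * gaussianDensity ((γ s)⁻¹ • (x - X s q)))
    (F' := fun s q => -(γ s ^ (d + 1))⁻¹ * (gaussianDensity ((γ s)⁻¹ • (x - X s q)) *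
        (γ' s * (d - ‖(γ s)⁻¹ • (x - X s q)‖ ^ 2) -
          inner ℝ ((γ s)⁻¹ • (x - X s q)) (V s q))))
    (bound := fun q => A * (Γ * (‖traceCLM d‖ * C₂) + C₁ * h q))
    (Filter.inter_mem hS (hA.and hΓ)) ?_ ?_ ?_ ?_ ?_ ?_
  · have h1 := key.2
    simp_rw [integral_const_mul] at h1
    refine h1.congr_deriv ?_
    rw [hX.divergence_smoothedFlux hh ht, neg_mul]
  · filter_upwards [hS] with s hs
    exact ((hX.integrable_gaussianDensity hs x).const_mul _).aestronglyMeasurable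
  · exact (hX.integrable_gaussianDensity ht x).const_mul _
  · have m1 := hX.measurable_path t ht
    have m2 := (hX.weight.stronglyMeasurable t ht).measurable
    have m3 := (continuous_gaussianDensity (d := d)).measurable
    exact Measurable.aestronglyMeasurable (by fun_prop)
  · refine ae_of_all _ fun q s hs => ?_
    obtain ⟨hs, hsA, hsΓ⟩ := hs
    set y := (γ s)⁻¹ • (x - X s q)
    have b1 : |gaussianDensity y * (d - ‖y‖ ^ 2)| ≤ ‖traceCLM d‖ * C₂ := by
      rw [← traceCLM_fderiv_gaussianDensity_smul_id, ← Real.norm_eq_abs]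
      exact (traceCLM d).le_of_opNorm_le_of_le le_rfl (hC₂ y)
    have b2 : |gaussianDensity y * inner ℝ y (V s q)| ≤ C₁ * h q := by
      rw [← real_inner_smul_left]
      exact (abs_real_inner_le_norm _ _).trans (mul_le_mul (hC₁ y) (hX.weight.norm_le s hs q)
        (norm_nonneg _) ((norm_nonneg _).trans (hC₁ y)))
    have b3 : gaussianDensity y * (γ' s * (d - ‖y‖ ^ 2) - inner ℝ y (V s q)) =
        γ' s * (gaussianDensity y * (d - ‖y‖ ^ 2)) - gaussianDensity y * inner ℝ y (V s q) := by
      ring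
    rw [b3, norm_mul, norm_neg]
    refine mul_le_mul hsA.le ((norm_sub_le _ _).trans (add_le_add ?_ b2)) (norm_nonneg _)
      (by positivity)
    rw [norm_mul]
    exact mul_le_mul hsΓ.le b1 (norm_nonneg _) (by positivity)
  · exact ((integrable_const _).add (hh.const_mul C₁)).const_mul A
  · exact ae_of_all _ fun q s hs => hX.hasDerivAt_kernel hs.1 x q

/-- The transport equation makes the time derivative minus a divergence, so `p + 1` space
derivatives of the flux give the `p` that are needed. -/
lemma IsDifferentiablePath.memC1Cp_smoothedDensity [IsFiniteMeasure ν]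
    (hX : IsDifferentiablePath S X V γ γ' h) (hh : Integrable h ν) (p : ℕ) :
    MemC1Cp S p (smoothedDensity ν X γ) := by
  refine ⟨hX.memC0Cp_smoothedDensity p, ?_, fun x t ht =>
    (hX.hasDerivAt_smoothedDensity hh ht x).differentiableAt.differentiableWithinAt⟩
  have h1 := (memC0Cp_succ_iff.1 (hX.memC0Cp_smoothedFlux (ν := ν) hh (p + 1))).2.2
  refine (h1.clm_comp (-traceCLM d)).congr fun t ht => ?_
  ext1 x
  rw [derivWithin_of_isOpen hX.isOpen ht, (hX.hasDerivAt_smoothedDensity hh ht x).deriv,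
    divergence_eq]
  simp

end SmoothingTime

/-! ### Identification of the law of the smoothed variable -/

section SmoothingLaw

variable {d : ℕ} {Q : Type*} [MeasurableSpace Q] {ν : Measure Q}

lemma lintegral_stdGaussian_add_smul (a : Rd d) {c : ℝ} (hc : 0 < c) {f : Rd d → ℝ≥0∞}
    (hf : Measurable f) :
    ∫⁻ z, f (a + c • z) ∂stdGaussian (Rd d) =
      ∫⁻ x, ENNReal.ofReal ((c ^ d)⁻¹ * gaussianDensity (c⁻¹ • (x - a))) * f x := by
  have mG := (continuous_gaussianDensity (d := d)).measurable
  set g : Rd d → ℝ≥0∞ := fun x => ENNReal.ofReal (gaussianDensity (c⁻¹ • (x - a))) * f x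
  have hg : Measurable g := by fun_prop
  have h1 : ∫⁻ z : Rd d, g (a + c • z) = ENNReal.ofReal (c ^ d)⁻¹ * ∫⁻ x, g x := by
    have h2 : ∫⁻ z : Rd d, g (a + c • z) =
        ∫⁻ x, g (a + x) ∂(Measure.map (c • ·) (volume : Measure (Rd d))) :=
      (lintegral_map (f := fun x => g (a + x)) (by fun_prop) (by fun_prop)).symm
    rw [h2, Measure.map_addHaar_smul _ hc.ne', lintegral_smul_measure, lintegral_add_left_eq_self]
    simp [abs_of_pos hc]
  rw [stdGaussian_eq_densityMeasure, densityMeasure,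
    lintegral_withDensity_eq_lintegral_mul _ (by fun_prop) (by fun_prop)]
  have h3 : ∀ x, ENNReal.ofReal ((c ^ d)⁻¹ * gaussianDensity (c⁻¹ • (x - a))) * f x =
      ENNReal.ofReal (c ^ d)⁻¹ * g x := fun x => by
    rw [ENNReal.ofReal_mul (by positivity), mul_assoc]
  simp_rw [h3]
  rw [lintegral_const_mul _ hg, ← h1]
  refine lintegral_congr fun z => ?_
  simp [g, smul_smul, hc.ne']

/-- The variable `q` is kept next to `x`: the flux depends on both, so the marginal law of `x` alone
would not suffice. -/
lemma map_prod_stdGaussian_eq_withDensity [SFinite ν] {a : Q → Rd d} (ha : Measurable a)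
    {c : ℝ} (hc : 0 < c) :
    (ν.prod (stdGaussian (Rd d))).map (fun p => (p.1, a p.1 + c • p.2)) =
      (ν.prod volume).withDensity fun p =>
        ENNReal.ofReal ((c ^ d)⁻¹ * gaussianDensity (c⁻¹ • (p.2 - a p.1))) := by
  have mG := (continuous_gaussianDensity (d := d)).measurable
  refine Measure.ext_of_lintegral _ fun f hf => ?_
  rw [lintegral_map hf (by fun_prop), lintegral_withDensity_eq_lintegral_mul _ (by fun_prop) hf,
    lintegral_prod _ (by fun_prop), lintegral_prod _ (by fun_prop)]
  refine lintegral_congr fun q => ?_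
  exact lintegral_stdGaussian_add_smul (a q) hc (f := fun x => f (q, x)) (by fun_prop)

lemma map_prod_stdGaussian_eq_densityMeasure [IsFiniteMeasure ν] {X : ℝ → Q → Rd d} {γ : ℝ → ℝ}
    {t : ℝ} (hX : Measurable (X t)) (hγ : 0 < γ t) :
    (ν.prod (stdGaussian (Rd d))).map (fun p => X t p.1 + γ t • p.2) =
      densityMeasure (smoothedDensity ν X γ t) := by
  have mG := (continuous_gaussianDensity (d := d)).measurable
  have h1 : (ν.prod (stdGaussian (Rd d))).map (fun p => X t p.1 + γ t • p.2) =
      ((ν.prod (stdGaussian (Rd d))).map (fun p => (p.1, X t p.1 + γ t • p.2))).map Prod.snd := by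
    rw [Measure.map_map (by fun_prop) (by fun_prop)]
    rfl
  rw [h1, map_prod_stdGaussian_eq_withDensity hX hγ]
  refine Measure.ext_of_lintegral _ fun f hf => ?_
  have hi : ∀ x, Integrable (fun q => gaussianDensity ((γ t)⁻¹ • (x - X t q))) ν := fun x => by
    obtain ⟨C, hC⟩ := (isGaussianTimesTemperate_gaussianDensity (d := d)).exists_norm_le
    exact (integrable_const C).mono' (Measurable.aestronglyMeasurable (by fun_prop))
      (ae_of_all _ fun q => hC _)
  have h2 : ∀ x, ENNReal.ofReal (smoothedDensity ν X γ t x) =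
      ∫⁻ q, ENNReal.ofReal ((γ t ^ d)⁻¹ * gaussianDensity ((γ t)⁻¹ • (x - X t q))) ∂ν := fun x => by
    rw [smoothedDensity, ← integral_const_mul]
    exact ofReal_integral_eq_lintegral_ofReal ((hi x).const_mul _)
      (ae_of_all _ fun q => mul_nonneg (by positivity) (gaussianDensity_pos _).le)
  have h3 : Measurable fun x => ENNReal.ofReal (smoothedDensity ν X γ t x) := by
    simp_rw [h2]
    exact Measurable.lintegral_prod_left' (f := fun p : Q × Rd d =>
      ENNReal.ofReal ((γ t ^ d)⁻¹ * gaussianDensity ((γ t)⁻¹ • (p.2 - X t p.1)))) (by fun_prop)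
  rw [lintegral_map hf measurable_snd, lintegral_withDensity_eq_lintegral_mul _ (by fun_prop)
    (by fun_prop), lintegral_prod_symm _ (by fun_prop), densityMeasure,
    lintegral_withDensity_eq_lintegral_mul _ h3 hf]
  refine lintegral_congr fun x => ?_
  simp only [Pi.mul_apply, h2]
  rw [lintegral_mul_const _ (by fun_prop)]

lemma integrable_smul_comp_of_integrable_prod [SFinite ν] {a : Q → Rd d} (ha : Measurable a)
    {c : ℝ} (hc : 0 < c) {E : Type*} [NormedAddCommGroup E] [NormedSpace ℝ E]
    {f : Q × Rd d → E} (hf : StronglyMeasurable f)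
    (hi : Integrable (fun p => f (p.1, a p.1 + c • p.2)) (ν.prod (stdGaussian (Rd d)))) :
    Integrable (fun p => ((c ^ d)⁻¹ * gaussianDensity (c⁻¹ • (p.2 - a p.1))) • f p)
      (ν.prod volume) := by
  have mG := (continuous_gaussianDensity (d := d)).measurable
  have h1 : Integrable f
      ((ν.prod (stdGaussian (Rd d))).map (fun p => (p.1, a p.1 + c • p.2))) :=
    (integrable_map_measure hf.aestronglyMeasurable (by fun_prop)).2 hi
  rw [map_prod_stdGaussian_eq_withDensity ha hc, integrable_withDensity_iff_integrable_smul'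
    (by fun_prop) (ae_of_all _ fun _ => by simp)] at h1
  refine h1.congr (ae_of_all _ fun p => ?_)
  simp only
  rw [ENNReal.toReal_ofReal (mul_nonneg (by positivity) (gaussianDensity_pos _).le)]

/-- Fubini for the joint law. With `f` the velocity as a function of `(q, x)`, this is the averaging
identity that characterises the conditional expectation. -/
lemma setIntegral_integral_gaussian_smul [SFinite ν] {a : Q → Rd d} (ha : Measurable a)
    {c : ℝ} (hc : 0 < c) {E : Type*} [NormedAddCommGroup E] [NormedSpace ℝ E]
    {f : Q × Rd d → E} (hf : StronglyMeasurable f)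
    (hi : Integrable (fun p => f (p.1, a p.1 + c • p.2)) (ν.prod (stdGaussian (Rd d))))
    {s : Set (Rd d)} (hs : MeasurableSet s) :
    ∫ x in s, ∫ q, ((c ^ d)⁻¹ * gaussianDensity (c⁻¹ • (x - a q))) • f (q, x) ∂ν =
      ∫ p in {p | a p.1 + c • p.2 ∈ s}, f (p.1, a p.1 + c • p.2)
        ∂ν.prod (stdGaussian (Rd d)) := by
  have mG := (continuous_gaussianDensity (d := d)).measurable
  have h1 := integrable_smul_comp_of_integrable_prod ha hc hf hi
  have hT : Measurable fun p : Q × Rd d => (p.1, a p.1 + c • p.2) := by fun_prop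
  have hs' : MeasurableSet (Prod.snd ⁻¹' s : Set (Q × Rd d)) := measurable_snd hs
  have h2 : ∫ p in {p | a p.1 + c • p.2 ∈ s}, f (p.1, a p.1 + c • p.2)
      ∂ν.prod (stdGaussian (Rd d)) = ∫ p in Prod.snd ⁻¹' s, f p
        ∂(ν.prod (stdGaussian (Rd d))).map (fun p => (p.1, a p.1 + c • p.2)) :=
    (setIntegral_map hs' hf.aestronglyMeasurable hT.aemeasurable).symm
  rw [h2, map_prod_stdGaussian_eq_withDensity ha hc, setIntegral_withDensity_eq_setIntegral_toReal_smul
    (by fun_prop) (ae_of_all _ fun _ => by simp) _ hs', ← univ_prod,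
    ← Measure.prod_restrict, Measure.restrict_univ, integral_prod_symm]
  · simp_rw [ENNReal.toReal_ofReal (mul_nonneg (inv_nonneg.2 (pow_pos hc d).le)
      (gaussianDensity_pos _).le)]
  · have h3 : Integrable (fun p => ((c ^ d)⁻¹ * gaussianDensity (c⁻¹ • (p.2 - a p.1))) • f p)
        (ν.prod (volume.restrict s)) := by
      rw [← Measure.restrict_univ (μ := ν), Measure.prod_restrict]
      exact h1.restrict
    refine h3.congr (ae_of_all _ fun p => ?_)
    simp only
    rw [ENNReal.toReal_ofReal (mul_nonneg (by positivity) (gaussianDensity_pos _).le)]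

end SmoothingLaw

/-! ### Conditional expectations as functions of the conditioning variable -/

section ConditionalExpectation

variable {d : ℕ} {Ω : Type*} [mΩ : MeasurableSpace Ω] {P : Measure Ω}
  {X Y : Ω → Rd d} {f : Rd d → Rd d} {ρ : Rd d → ℝ}

/-- Doob–Dynkin factorisation of a function measurable for the σ-algebra of `X`. -/
lemma exists_isCondExpGiven (X : Ω → Rd d) (hY : Integrable Y P) :
    ∃ c, IsCondExpGiven P Y X c := by
  obtain ⟨c, hc, hc'⟩ := (stronglyMeasurable_condExp (μ := P) (f := Y)
    (m := MeasurableSpace.comap X inferInstance)).exists_eq_measurable_comp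
  exact ⟨c, hY, hc.measurable, by rw [hc']; rfl⟩

lemma IsCondExpGiven.integrable_comp (h : IsCondExpGiven P Y X f) :
    Integrable (fun w => f (X w)) P :=
  integrable_condExp.congr h.2.2.symm

lemma IsCondExpGiven.integral_inner [IsFiniteMeasure P] (h : IsCondExpGiven P Y X f) (hX : Measurable X)
    {ψ : Rd d → Rd d} (hψ : Continuous ψ) {C : ℝ} (hC : ∀ x, ‖ψ x‖ ≤ C) :
    ∫ w, inner ℝ (ψ (X w)) (f (X w)) ∂P = ∫ w, inner ℝ (ψ (X w)) (Y w) ∂P := by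
  have hm : MeasurableSpace.comap X inferInstance ≤ mΩ := hX.comap_le
  have h1 : StronglyMeasurable[MeasurableSpace.comap X inferInstance] fun w => ψ (X w) :=
    hψ.comp_stronglyMeasurable (comap_measurable X).stronglyMeasurable
  have h2 := condExp_stronglyMeasurable_bilin_of_bound (innerSL ℝ) hm h1 h.1 C
    (ae_of_all _ fun w => hC _)
  rw [← integral_condExp hm (f := fun w => inner ℝ (ψ (X w)) (Y w))]
  refine integral_congr_ae ?_
  filter_upwards [h2, h.2.2] with w hw hw'
  rw [hw']
  exact hw.symm

/-- Conditional Jensen: `‖E[Y | X]‖² ≤ E[‖Y‖² | X]`, and the right side is integrable. -/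
lemma IsCondExpGiven.integrable_norm_sq [IsFiniteMeasure P] (h : IsCondExpGiven P Y X f)
    (hY : MemLp Y 2 P) : Integrable (fun w => ‖f (X w)‖ ^ 2) P := by
  have h1 : Integrable (fun w => ‖Y w‖ ^ (2 : ℝ)) P := by
    simpa using hY.integrable_norm_pow (by norm_num)
  have h2 := Integrable.norm_condExp_rpow_le (m := MeasurableSpace.comap X inferInstance)
    (by norm_num) h1
  refine (integrable_condExp (m := MeasurableSpace.comap X inferInstance) (μ := P)
    (f := fun w => ‖Y w‖ ^ (2 : ℝ))).mono' (h.integrable_comp.aestronglyMeasurable.norm.pow 2) ?_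
  filter_upwards [h2, h.2.2] with w hw hw'
  rw [hw']
  simpa using hw

/-- Independence gives `E[Z | X] = E[Z] = 0`. This is needed at the endpoints, where the latent
variable drops out of `x_t`. -/
lemma IsCondExpGiven.add_smul_of_indepFun [IsFiniteMeasure P] (h : IsCondExpGiven P Y X f) (hX : Measurable X)
    {Z : Ω → Rd d} (hZ : Measurable Z) (hi : Integrable Z P) (h0 : ∫ w, Z w ∂P = 0)
    (hXZ : IndepFun X Z P) (a : ℝ) : IsCondExpGiven P (fun w => Y w + a • Z w) X f := by
  refine ⟨h.1.add (hi.smul a), h.2.1, ?_⟩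
  have h1 := condExp_indep_eq (m₁ := MeasurableSpace.comap Z inferInstance)
    (m₂ := MeasurableSpace.comap X inferInstance) (μ := P) (f := Z) hZ.comap_le hX.comap_le
    (comap_measurable Z).stronglyMeasurable hXZ.symm
  filter_upwards [h.2.2, h1, condExp_add h.1 (hi.smul a) (MeasurableSpace.comap X inferInstance),
    condExp_smul a Z (MeasurableSpace.comap X inferInstance) (μ := P)] with w h2 h3 h4 h5
  refine h2.trans ?_
  have h6 : (P[fun w => Y w + a • Z w | MeasurableSpace.comap X inferInstance]) w = _ := h4
  rw [h6, Pi.add_apply, h5, Pi.smul_apply, h3, h0, smul_zero, add_zero]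

lemma integral_densityMeasure {F : Type*} [NormedAddCommGroup F] [NormedSpace ℝ F]
    (hρ : Measurable ρ) (h0 : ∀ x, 0 ≤ ρ x) (g : Rd d → F) :
    ∫ x, g x ∂densityMeasure ρ = ∫ x, ρ x • g x := by
  rw [densityMeasure, integral_withDensity_eq_integral_toReal_smul hρ.ennreal_ofReal
    (ae_of_all _ fun _ => by simp)]
  simp_rw [ENNReal.toReal_ofReal (h0 _)]

lemma setIntegral_densityMeasure {F : Type*} [NormedAddCommGroup F] [NormedSpace ℝ F]
    (hρ : Measurable ρ) (h0 : ∀ x, 0 ≤ ρ x) (g : Rd d → F) {s : Set (Rd d)}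
    (hs : MeasurableSet s) :
    ∫ x in s, g x ∂densityMeasure ρ = ∫ x in s, ρ x • g x := by
  rw [densityMeasure, setIntegral_withDensity_eq_setIntegral_toReal_smul hρ.ennreal_ofReal
    (ae_of_all _ fun _ => by simp) _ hs]
  simp_rw [ENNReal.toReal_ofReal (h0 _)]

lemma integrable_densityMeasure_iff {F : Type*} [NormedAddCommGroup F] [NormedSpace ℝ F]
    (hρ : Measurable ρ) (h0 : ∀ x, 0 ≤ ρ x) (g : Rd d → F) :
    Integrable g (densityMeasure ρ) ↔ Integrable fun x => ρ x • g x := by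
  rw [densityMeasure, integrable_withDensity_iff_integrable_smul' hρ.ennreal_ofReal
    (ae_of_all _ fun _ => by simp)]
  simp_rw [ENNReal.toReal_ofReal (h0 _)]

end ConditionalExpectation

/-! ### The velocity at interior times -/

section InteriorVelocity

variable {d : ℕ} {Ω Q : Type*} [mΩ : MeasurableSpace Ω] [MeasurableSpace Q] {P : Measure Ω}
  {ν : Measure Q} [IsProbabilityMeasure ν] {S : Set ℝ}
  {X V : ℝ → Q → Rd d} {γ γ' : ℝ → ℝ} {h : Q → ℝ} {W : Ω → Q} {Z : Ω → Rd d}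

lemma map_path_eq_densityMeasure (hW : Measurable W) (hZ : Measurable Z)
    (hlaw : P.map (fun w => (W w, Z w)) = ν.prod (stdGaussian (Rd d)))
    (hX : IsDifferentiablePath S X V γ γ' h) {t : ℝ} (ht : t ∈ S) :
    P.map (fun w => X t (W w) + γ t • Z w) = densityMeasure (smoothedDensity ν X γ t) := by
  have m1 := hX.measurable_path t ht
  rw [← map_prod_stdGaussian_eq_densityMeasure m1 (hX.scale_pos t ht), ← hlaw,
    Measure.map_map (by fun_prop) (by fun_prop)]
  rfl

/-- On each event `{x_t ∈ B}` both the velocity and the candidate `j / ρ` integrate to `∫_B j`, the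
latter because the law of `x_t` has density `ρ`. -/
lemma IsDifferentiablePath.isCondExpGiven [IsFiniteMeasure P] (hX : IsDifferentiablePath S X V γ γ' h)
    (hh : Integrable h ν) (hW : Measurable W) (hZ : Measurable Z)
    (hlaw : P.map (fun w => (W w, Z w)) = ν.prod (stdGaussian (Rd d))) {t : ℝ} (ht : t ∈ S)
    (hint : Integrable (fun w => V t (W w) + γ' t • Z w) P) :
    IsCondExpGiven P (fun w => V t (W w) + γ' t • Z w) (fun w => X t (W w) + γ t • Z w)
      (fun x => (smoothedDensity ν X γ t x)⁻¹ • smoothedFlux ν X V γ γ' t x) := by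
  have m1 := hX.measurable_path t ht
  have m2 := hX.weight.stronglyMeasurable t ht
  have hc := hX.scale_pos t ht
  have hρ := ((hX.memC0Cp_smoothedDensity (ν := ν) 0).1 t ht).continuous
  have hj := ((hX.memC0Cp_smoothedFlux hh 0).1 t ht).continuous
  have hpos := hX.smoothedDensity_pos (ν := ν) ht
  have hmeas : Measurable fun x => (smoothedDensity ν X γ t x)⁻¹ • smoothedFlux ν X V γ γ' t x :=
    hρ.measurable.inv.smul hj.measurable
  have hmp : Measurable fun w => X t (W w) + γ t • Z w := by fun_prop
  have hmap := map_path_eq_densityMeasure hW hZ hlaw hX ht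
  -- The velocity in terms of `(q, x_t)`: `z` is recovered as `(x_t - X) / γ`.
  set f : Q × Rd d → Rd d := fun p => V t p.1 + γ' t • (γ t)⁻¹ • (p.2 - X t p.1) with hf_def
  have hf : StronglyMeasurable f := by
    refine Measurable.stronglyMeasurable ?_
    have := m2.measurable
    fun_prop
  have hfT : ∀ p : Q × Rd d, f (p.1, X t p.1 + γ t • p.2) = V t p.1 + γ' t • p.2 := fun p => by
    simp [hf_def, smul_smul, hc.ne']
  have hi : Integrable (fun p : Q × Rd d => f (p.1, X t p.1 + γ t • p.2))
      (ν.prod (stdGaussian (Rd d))) := by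
    simp_rw [hfT]
    rw [← hlaw, integrable_map_measure _ (by fun_prop)]
    · exact hint
    · have := m2.measurable
      exact Measurable.aestronglyMeasurable (by fun_prop)
  have hflux : ∀ x, smoothedFlux ν X V γ γ' t x = ∫ q, ((γ t ^ d)⁻¹ *
      gaussianDensity ((γ t)⁻¹ • (x - X t q))) • f (q, x) ∂ν := fun x => by
    rw [smoothedFlux, ← integral_smul]
    simp only [hf_def, mul_smul]
  have hji : Integrable (smoothedFlux ν X V γ γ' t) := by
    have := (integrable_smul_comp_of_integrable_prod m1 hc hf hi).integral_prod_right
    simpa only [← hflux] using this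
  have hcancel : ∀ x, smoothedDensity ν X γ t x •
      (smoothedDensity ν X γ t x)⁻¹ • smoothedFlux ν X V γ γ' t x =
        smoothedFlux ν X V γ γ' t x := fun x => by
    rw [smul_smul, mul_inv_cancel₀ (hpos x).ne', one_smul]
  have hbi : Integrable (fun w => (smoothedDensity ν X γ t (X t (W w) + γ t • Z w))⁻¹ •
      smoothedFlux ν X V γ γ' t (X t (W w) + γ t • Z w)) P := by
    refine (integrable_map_measure hmeas.aestronglyMeasurable hmp.aemeasurable).1 ?_
    rw [hmap, integrable_densityMeasure_iff hρ.measurable fun x => (hpos x).le]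
    simp_rw [hcancel]
    exact hji
  refine ⟨hint, hmeas, ae_eq_condExp_of_forall_setIntegral_eq hmp.comap_le hint
    (fun s _ _ => hbi.integrableOn) ?_ ?_⟩
  · rintro _ ⟨B, hB, rfl⟩ -
    have e1 := setIntegral_map (μ := P) (f := fun x => (smoothedDensity ν X γ t x)⁻¹ •
      smoothedFlux ν X V γ γ' t x) hB hmeas.aestronglyMeasurable hmp.aemeasurable
    rw [← e1, hmap, setIntegral_densityMeasure hρ.measurable (fun x => (hpos x).le) _ hB]
    simp_rw [hcancel, hflux]
    rw [setIntegral_integral_gaussian_smul m1 hc hf hi hB, ← hlaw]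
    simp_rw [hfT]
    have hB' : MeasurableSet {p : Q × Rd d | X t p.1 + γ t • p.2 ∈ B} :=
      measurableSet_preimage (f := fun p : Q × Rd d => X t p.1 + γ t • p.2) (by fun_prop) hB
    rw [setIntegral_map hB' _ (by fun_prop)]
    · rfl
    · have := m2.measurable
      exact Measurable.aestronglyMeasurable (by fun_prop)
  · exact (hmeas.comp (comap_measurable _)).aestronglyMeasurable

end InteriorVelocity

/-! ### Consequences of the regularity of `γ²` -/

section LatentScale

variable {γ : ℝ → ℝ}

lemma IsLatentScale.nonneg (hγ : IsLatentScale γ) {t : ℝ} (ht : t ∈ Icc (0 : ℝ) 1) : 0 ≤ γ t := by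
  rcases ht.1.eq_or_lt with rfl | h0
  · exact hγ.at_zero.ge
  rcases ht.2.eq_or_lt with rfl | h1
  · exact hγ.at_one.ge
  exact (hγ.pos t ⟨h0, h1⟩).le

lemma IsLatentScale.continuousOn (hγ : IsLatentScale γ) : ContinuousOn γ (Icc 0 1) :=
  (hγ.contDiff_sq.continuousOn.sqrt).congr fun t ht => by simp [Real.sqrt_sq (hγ.nonneg ht)]

lemma IsLatentScale.continuousOn_derivWithin_sq (hγ : IsLatentScale γ) :
    ContinuousOn (derivWithin (fun s => γ s ^ 2) (Icc 0 1)) (Icc 0 1) :=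
  hγ.contDiff_sq.continuousOn_derivWithin (uniqueDiffOn_Icc zero_lt_one) (by norm_num)

lemma IsLatentScale.differentiableAt (hγ : IsLatentScale γ) {t : ℝ} (ht : t ∈ Ioo (0 : ℝ) 1) :
    DifferentiableAt ℝ γ t := by
  have h1 : DifferentiableAt ℝ (fun s => γ s ^ 2) t :=
    (hγ.contDiff_sq.contDiffAt (Icc_mem_nhds ht.1 ht.2)).differentiableAt (by norm_num)
  refine (h1.sqrt (pow_pos (hγ.pos t ht) 2).ne').congr_of_eventuallyEq ?_
  filter_upwards [Icc_mem_nhds ht.1 ht.2] with s hs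
  rw [Real.sqrt_sq (hγ.nonneg hs)]

lemma IsLatentScale.hasDerivAt (hγ : IsLatentScale γ) {t : ℝ} (ht : t ∈ Ioo (0 : ℝ) 1) :
    HasDerivAt γ (derivWithin γ (Icc 0 1) t) t := by
  rw [derivWithin_of_mem_nhds (Icc_mem_nhds ht.1 ht.2)]
  exact (hγ.differentiableAt ht).hasDerivAt

lemma derivWithin_sq_of_differentiableWithinAt {t : ℝ} (ht : t ∈ Icc (0 : ℝ) 1)
    (h : DifferentiableWithinAt ℝ γ (Icc 0 1) t) :
    derivWithin (fun s => γ s ^ 2) (Icc 0 1) t = 2 * γ t * derivWithin γ (Icc 0 1) t := by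
  simpa using (h.hasDerivWithinAt.fun_pow 2).derivWithin (uniqueDiffOn_Icc zero_lt_one t ht)

/-- The right side is continuous on all of `[0,1]` even if `γ'` is unbounded near the endpoints; for
the same reason only the product `γ' γ` is used there. -/
lemma IsLatentScale.mul_derivWithin (hγ : IsLatentScale γ) {t : ℝ} (ht : t ∈ Ioo (0 : ℝ) 1) :
    derivWithin γ (Icc 0 1) t * γ t = 1 / 2 * derivWithin (fun s => γ s ^ 2) (Icc 0 1) t := by
  rw [derivWithin_sq_of_differentiableWithinAt (Ioo_subset_Icc_self ht)
    (hγ.differentiableAt ht).differentiableWithinAt]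
  ring

lemma IsLatentScale.continuousOn_derivWithin (hγ : IsLatentScale γ) :
    ContinuousOn (derivWithin γ (Icc 0 1)) (Ioo 0 1) := by
  have h1 : ContinuousOn (fun t => 1 / 2 * derivWithin (fun s => γ s ^ 2) (Icc 0 1) t / γ t)
      (Ioo 0 1) :=
    ((hγ.continuousOn_derivWithin_sq.mono Ioo_subset_Icc_self).const_mul _).div
      (hγ.continuousOn.mono Ioo_subset_Icc_self) fun t ht => (hγ.pos t ht).ne'
  refine h1.congr fun t ht => ?_
  simp only
  rw [← hγ.mul_derivWithin ht, mul_div_cancel_right₀ _ (hγ.pos t ht).ne']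

end LatentScale

/-! ### Measurability and domination of `∂ₜI` -/

section InterpolationMap

variable {d : ℕ} {I : ℝ → Rd d → Rd d → Rd d} {ν : Measure (Rd d × Rd d)}

lemma IsInterpolationMap.hasDerivWithinAt (hI : IsInterpolationMap I) {t : ℝ}
    (ht : t ∈ Icc (0 : ℝ) 1) (x₀ x₁ : Rd d) :
    HasDerivWithinAt (fun s => I s x₀ x₁) (dtI I t x₀ x₁) (Icc 0 1) t :=
  ((hI.contDiff_time x₀ x₁).differentiableOn (by norm_num) t ht).hasDerivWithinAt

lemma IsInterpolationMap.hasDerivAt (hI : IsInterpolationMap I) {t : ℝ}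
    (ht : t ∈ Ioo (0 : ℝ) 1) (x₀ x₁ : Rd d) :
    HasDerivAt (fun s => I s x₀ x₁) (dtI I t x₀ x₁) t :=
  (hI.hasDerivWithinAt (Ioo_subset_Icc_self ht) x₀ x₁).hasDerivAt (Icc_mem_nhds ht.1 ht.2)

lemma IsInterpolationMap.continuousOn_dtI (hI : IsInterpolationMap I) (x₀ x₁ : Rd d) :
    ContinuousOn (fun t => dtI I t x₀ x₁) (Icc 0 1) :=
  (hI.contDiff_time x₀ x₁).continuousOn_derivWithin (uniqueDiffOn_Icc zero_lt_one) (by norm_num)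

lemma IsInterpolationMap.measurable (hI : IsInterpolationMap I) {t : ℝ}
    (ht : t ∈ Icc (0 : ℝ) 1) : Measurable fun q : Rd d × Rd d => I t q.1 q.2 :=
  (hI.contDiff_space t ht).continuous.measurable

/-- A pointwise limit of difference quotients along a sequence in `[0,1]`; joint regularity of `I`
in time and space is not assumed. -/
lemma IsInterpolationMap.measurable_dtI (hI : IsInterpolationMap I) {t : ℝ}
    (ht : t ∈ Icc (0 : ℝ) 1) : Measurable fun q : Rd d × Rd d => dtI I t q.1 q.2 := by
  have h1 : t ∈ closure (Icc (0 : ℝ) 1 \ {t}) := by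
    have := uniqueDiffWithinAt_iff_accPt.1 (uniqueDiffOn_Icc (zero_lt_one (α := ℝ)) t ht)
    rw [accPt_principal_iff_clusterPt] at this
    exact mem_closure_iff_clusterPt.2 this
  obtain ⟨s, hs, hst⟩ := mem_closure_iff_seq_limit.1 h1
  refine measurable_of_tendsto_metrizable
    (f := fun n q => (s n - t)⁻¹ • (I (s n) q.1 q.2 - I t q.1 q.2)) (fun n => ?_) ?_
  · exact ((hI.measurable (hs n).1).sub (hI.measurable ht)).const_smul (s n - t)⁻¹
  · rw [tendsto_pi_nhds]
    intro q
    have h2 := hasDerivWithinAt_iff_tendsto_slope.1 (hI.hasDerivWithinAt ht q.1 q.2)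
    exact h2.comp (tendsto_nhdsWithin_iff.2 ⟨hst, Filter.Eventually.of_forall hs⟩)

lemma IsInterpolationMap.memLp_dtI (hI : IsInterpolationMap I) (hM : HasMomentBounds ν I) {t : ℝ}
    (ht : t ∈ Icc (0 : ℝ) 1) : MemLp (fun q : Rd d × Rd d => dtI I t q.1 q.2) 4 ν := by
  obtain ⟨M, hM⟩ := hM.fourth
  refine ⟨(hI.measurable_dtI ht).aestronglyMeasurable, ?_⟩
  rw [eLpNorm_lt_top_iff_lintegral_rpow_enorm_lt_top (by norm_num) (by norm_num)]
  have h1 := hM t ht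
  refine lt_of_le_of_lt ?_ (ENNReal.coe_lt_top (r := M))
  convert! h1 using 4
  norm_num

/-- The speed bound offers `C |x₀ - x₁|`. It is integrable since `|x₁ - x₀| ≤ ∫ |∂ₜI| dt`, by
Tonelli and `a ≤ 1 + a⁴` with the fourth moment bound. -/
lemma IsInterpolationMap.exists_integrable_bound [IsProbabilityMeasure ν]
    (hI : IsInterpolationMap I) (hM : HasMomentBounds ν I) :
    ∃ h : Rd d × Rd d → ℝ, Integrable h ν ∧
      IsDominatedWeight (Icc 0 1) (fun t (q : Rd d × Rd d) => dtI I t q.1 q.2) h := by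
  obtain ⟨C, hC⟩ := hI.speed_le
  refine ⟨fun q => C * ‖q.1 - q.2‖, ?_, fun t ht => (hI.measurable_dtI ht).stronglyMeasurable,
    fun q => hI.continuousOn_dtI q.1 q.2, fun t ht q => hC t ht q.1 q.2⟩
  suffices h : Integrable (fun q : Rd d × Rd d => q.1 - q.2) ν from h.norm.const_mul C
  obtain ⟨M, hM⟩ := hM.fourth
  -- Clamping time to `[0,1]` makes `u` continuous in `t` on the whole line, hence jointly
  -- measurable, as Tonelli requires.
  set u : ℝ → Rd d × Rd d → Rd d := fun t q => dtI I (projIcc 0 1 zero_le_one t) q.1 q.2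
  have hu : Measurable (Function.uncurry u) := by
    refine measurable_uncurry_of_continuous_of_measurable (fun q => ?_) fun t =>
      hI.measurable_dtI (projIcc 0 1 zero_le_one t).2
    exact (hI.continuousOn_dtI q.1 q.2).comp_continuous
      (continuous_subtype_val.comp continuous_projIcc) fun t => (projIcc 0 1 zero_le_one t).2
  have h1 : ∀ q : Rd d × Rd d, ‖q.1 - q.2‖ₑ ≤ ∫⁻ t in Ioc 0 1, ‖u t q‖ₑ := fun q => by
    have e1 : ∫ t in (0 : ℝ)..1, dtI I t q.1 q.2 = q.2 - q.1 := by
      have := intervalIntegral.integral_eq_sub_of_hasDerivAt_of_le zero_le_one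
        (hI.contDiff_time q.1 q.2).continuousOn (fun t ht => hI.hasDerivAt ht q.1 q.2)
        ((hI.continuousOn_dtI q.1 q.2).intervalIntegrable_of_Icc zero_le_one)
      simpa [hI.at_zero, hI.at_one] using this
    have e2 : ∫ t in Ioc (0 : ℝ) 1, u t q = q.2 - q.1 := by
      rw [← e1, intervalIntegral.integral_of_le zero_le_one]
      refine setIntegral_congr_fun measurableSet_Ioc fun t ht => ?_
      simp only [u, projIcc_of_mem zero_le_one (Ioc_subset_Icc_self ht)]
    rw [← enorm_neg, neg_sub, ← e2]
    exact enorm_integral_le_lintegral_enorm _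
  have h2 : ∀ t, ∫⁻ q, ‖u t q‖ₑ ∂ν ≤ 1 + M := fun t => by
    have e3 : ∀ a : ℝ≥0∞, a ≤ 1 + a ^ 4 := fun a => by
      rcases le_total a 1 with h | h
      · exact h.trans le_self_add
      · exact (le_self_pow₀ h (by norm_num)).trans le_add_self
    calc ∫⁻ q, ‖u t q‖ₑ ∂ν ≤ ∫⁻ q, 1 + ‖u t q‖ₑ ^ 4 ∂ν := lintegral_mono fun q => e3 _
      _ = 1 + ∫⁻ q, ‖u t q‖ₑ ^ 4 ∂ν := by
        rw [lintegral_add_left measurable_const]; simp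
      _ ≤ 1 + M := by gcongr; exact hM _ (projIcc (0 : ℝ) 1 zero_le_one t).2
  refine ⟨(measurable_fst.sub measurable_snd).aestronglyMeasurable, ?_⟩
  calc ∫⁻ q : Rd d × Rd d, ‖q.1 - q.2‖ₑ ∂ν ≤ ∫⁻ q, (∫⁻ t in Ioc (0 : ℝ) 1, ‖u t q‖ₑ) ∂ν :=
        lintegral_mono h1
    _ = ∫⁻ t in Ioc (0 : ℝ) 1, ∫⁻ q, ‖u t q‖ₑ ∂ν :=
        lintegral_lintegral_swap (hu.comp measurable_swap).enorm.aemeasurable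
    _ ≤ ∫⁻ t in Ioc (0 : ℝ) 1, (1 + M) := lintegral_mono fun t => h2 t
    _ < ⊤ := by simp

end InterpolationMap

lemma IsDominatedWeight.mono {Q : Type*} [MeasurableSpace Q] {F₁ : Type}
    [NormedAddCommGroup F₁] {S S' : Set ℝ} {w : ℝ → Q → F₁} {h : Q → ℝ}
    (hw : IsDominatedWeight S w h) (hS : S' ⊆ S) : IsDominatedWeight S' w h :=
  ⟨fun t ht => hw.stronglyMeasurable t (hS ht), fun q => (hw.continuousOn q).mono hS,
    fun t ht => hw.norm_le t (hS ht)⟩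

lemma IsInterpolationMap.isDifferentiablePath {d : ℕ} {I : ℝ → Rd d → Rd d → Rd d} {γ : ℝ → ℝ}
    {h : Rd d × Rd d → ℝ} (hI : IsInterpolationMap I) (hγ : IsLatentScale γ)
    (hw : IsDominatedWeight (Icc 0 1) (fun t (q : Rd d × Rd d) => dtI I t q.1 q.2) h) :
    IsDifferentiablePath (Ioo 0 1) (fun t (q : Rd d × Rd d) => I t q.1 q.2)
      (fun t q => dtI I t q.1 q.2) γ (derivWithin γ (Icc 0 1)) h where
  isOpen := isOpen_Ioo
  scale_pos := hγ.pos
  hasDerivAt_scale _ ht := hγ.hasDerivAt ht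
  continuousOn_scale_deriv := hγ.continuousOn_derivWithin
  measurable_path _ ht := hI.measurable (Ioo_subset_Icc_self ht)
  hasDerivAt_path _ ht q := hI.hasDerivAt ht q.1 q.2
  weight := hw.mono Ioo_subset_Icc_self

/-! ### Integration by parts and Stein's identity -/

section IntegrationByParts

variable {d : ℕ}

lemma continuous_divergence {ψ : Rd d → Rd d} (hψ : ContDiff ℝ 1 ψ) :
    Continuous (divergence ψ) := by
  have h : divergence ψ = fun x => traceCLM d (fderiv ℝ ψ x) := funext fun x => divergence_eq ψ x
  rw [h]
  exact (traceCLM d).continuous.comp (hψ.continuous_fderiv (by norm_num))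

lemma hasCompactSupport_divergence {ψ : Rd d → Rd d} (hψ : HasCompactSupport ψ) :
    HasCompactSupport (divergence ψ) := by
  have h : divergence ψ = fun x => traceCLM d (fderiv ℝ ψ x) := funext fun x => divergence_eq ψ x
  rw [h]
  exact (hψ.fderiv ℝ).comp_left (map_zero _)

lemma integral_fderiv_apply_eq_neg_integral_divergence {ψ : Rd d → Rd d} {ρ : Rd d → ℝ}
    (hψ : ContDiff ℝ 1 ψ) (hc : HasCompactSupport ψ) (hρ : ContDiff ℝ 1 ρ) :
    ∫ x, fderiv ℝ ρ x (ψ x) = -∫ x, ρ x * divergence ψ x := by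
  have hρ' := hρ.continuous_fderiv (by norm_num)
  have hψ' := hψ.continuous_fderiv (by norm_num)
  have hci : ∀ i, HasCompactSupport fun x => ψ x i := fun i =>
    hc.comp_left (g := fun v : Rd d => v i) rfl
  have hdi : ∀ i x, HasFDerivAt (fun x => ψ x i)
      ((EuclideanSpace.proj i).comp (fderiv ℝ ψ x)) x := fun i x =>
    (EuclideanSpace.proj (𝕜 := ℝ) i).hasFDerivAt.comp x
      (hψ.differentiable (by norm_num) x).hasFDerivAt
  have hdi' : ∀ i x, fderiv ℝ (fun x => ψ x i) x (EuclideanSpace.single i 1) =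
      fderiv ℝ ψ x (EuclideanSpace.single i 1) i := fun i x => by
    rw [(hdi i x).fderiv]; rfl
  have hcd : ∀ i, HasCompactSupport fun x => fderiv ℝ ψ x (EuclideanSpace.single i 1) i :=
    fun i => (hc.fderiv ℝ).comp_left (g := fun L : Rd d →L[ℝ] Rd d =>
      L (EuclideanSpace.single i 1) i) rfl
  have i1 : ∀ i, Integrable fun x => ψ x i * fderiv ℝ ρ x (EuclideanSpace.single i 1) := fun i =>
    Continuous.integrable_of_hasCompactSupport
      (by have := hψ.continuous; fun_prop) ((hci i).mul_right)
  have i2 : ∀ i, Integrable fun x => fderiv ℝ ψ x (EuclideanSpace.single i 1) i * ρ x := fun i =>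
    Continuous.integrable_of_hasCompactSupport
      (by have := hρ.continuous; fun_prop) ((hcd i).mul_right)
  have i3 : ∀ i, Integrable fun x => ψ x i * ρ x := fun i =>
    Continuous.integrable_of_hasCompactSupport
      (by have := hρ.continuous; have := hψ.continuous; fun_prop) ((hci i).mul_right)
  have key : ∀ i, ∫ x, ψ x i * fderiv ℝ ρ x (EuclideanSpace.single i 1) =
      -∫ x, fderiv ℝ ψ x (EuclideanSpace.single i 1) i * ρ x := fun i => by
    have := integral_mul_fderiv_eq_neg_fderiv_mul_of_integrable (μ := (volume : Measure (Rd d)))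
      (f := fun x => ψ x i) (g := ρ) (v := EuclideanSpace.single i 1)
      (by simpa only [hdi'] using i2 i) (i1 i) (i3 i)
      (fun x _ => (hdi i x).differentiableAt)
      (fun x _ => hρ.differentiable (by norm_num) x)
    simpa only [hdi'] using this
  have e1 : ∀ x, fderiv ℝ ρ x (ψ x) =
      ∑ i, ψ x i * fderiv ℝ ρ x (EuclideanSpace.single i 1) := fun x => by
    rw [← sum_apply_single_mul]
    simp_rw [mul_comm]
  have e2 : ∀ x, ρ x * divergence ψ x =
      ∑ i, fderiv ℝ ψ x (EuclideanSpace.single i 1) i * ρ x := fun x => by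
    rw [divergence, Finset.mul_sum]
    simp_rw [mul_comm]
  simp_rw [e1, e2]
  rw [integral_finsetSum _ fun i _ => i1 i, integral_finsetSum _ fun i _ => i2 i,
    ← Finset.sum_neg_distrib]
  exact Finset.sum_congr rfl fun i _ => key i

/-- Stein's identity: integrate by parts against `g`, using `∇g = -z g`. The factor `c` comes from
the chain rule, and `c ≠ 0` keeps the support of `z ↦ ψ (a + c z)` compact. -/
lemma integral_inner_stdGaussian {ψ : Rd d → Rd d} (hψ : ContDiff ℝ 1 ψ)
    (hc : HasCompactSupport ψ) (a : Rd d) {c : ℝ} (hc0 : c ≠ 0) :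
    ∫ z, inner ℝ (ψ (a + c • z)) z ∂stdGaussian (Rd d) =
      c * ∫ z, divergence ψ (a + c • z) ∂stdGaussian (Rd d) := by
  have hs : HasCompactSupport fun z => ψ (a + c • z) :=
    hc.comp_homeomorph ((Homeomorph.smulOfNeZero c hc0).trans (Homeomorph.addLeft a))
  have hd : ContDiff ℝ 1 fun z => ψ (a + c • z) := by fun_prop
  have h1 := integral_fderiv_apply_eq_neg_integral_divergence hd hs
    ((contDiff_gaussianDensity (d := d)).of_le (by simp))
  have h2 : ∀ z, divergence (fun z => ψ (a + c • z)) z = c * divergence ψ (a + c • z) :=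
    fun z => by
    have h3 : HasFDerivAt (fun z : Rd d => a + c • z) (c • ContinuousLinearMap.id ℝ (Rd d)) z :=
      ((hasFDerivAt_id z).fun_const_smul c).const_add a
    have h4 := (hψ.differentiable (by norm_num) (a + c • z)).hasFDerivAt.comp z h3
    have h5 : fderiv ℝ (fun z => ψ (a + c • z)) z = c • fderiv ℝ ψ (a + c • z) :=
      h4.fderiv.trans (by ext v; simp)
    rw [divergence_eq, h5, map_smul, divergence_eq, smul_eq_mul]
  rw [integral_stdGaussian, integral_stdGaussian, ← integral_const_mul, ← neg_inj]
  simp_rw [(hasFDerivAt_gaussianDensity _).fderiv, h2] at h1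
  rw [← integral_neg]
  convert! h1 using 2
  · ext z
    simp [real_inner_comm]
  · congr 1
    ext z
    simp
    ring

end IntegrationByParts

/-- A mean value argument: a limit of interior derivatives at an endpoint is the one-sided
derivative there. -/
lemma hasDerivWithinAt_Icc_of_hasDerivAt_Ioo {f f' : ℝ → ℝ} (hf : ContinuousOn f (Icc 0 1))
    (hf' : ContinuousOn f' (Icc 0 1)) (h : ∀ t ∈ Ioo (0 : ℝ) 1, HasDerivAt f (f' t) t) {t : ℝ}
    (ht : t ∈ Icc (0 : ℝ) 1) : HasDerivWithinAt f (f' t) (Icc 0 1) t := by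
  have hcl : closure (Ioo (0 : ℝ) 1) = Icc 0 1 := closure_Ioo zero_ne_one
  rw [hasDerivWithinAt_iff_hasFDerivWithinAt, ← hcl]
  refine hasFDerivWithinAt_closure_of_tendsto_fderiv
    (fun s hs => (h s hs).differentiableAt.differentiableWithinAt) (convex_Ioo 0 1) isOpen_Ioo
    (fun s hs => (hf s (hcl ▸ hs)).mono Ioo_subset_Icc_self) ?_
  have h1 : Filter.Tendsto (fun s => ContinuousLinearMap.toSpanSingleton ℝ (f' s))
      (nhdsWithin t (Ioo 0 1)) (nhds (ContinuousLinearMap.toSpanSingleton ℝ (f' t))) :=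
    (ContinuousLinearMap.toSpanSingletonCLE (𝕜 := ℝ) (E := ℝ)).continuous.continuousAt.tendsto.comp
      ((hf' t ht).mono Ioo_subset_Icc_self)
  refine h1.congr' ?_
  filter_upwards [self_mem_nhdsWithin] with s hs
  exact (h s hs).hasFDerivAt.fderiv.symm

/-- A stochastic interpolant whose velocity is dominated by `h(x₀, x₁)` and square-integrable. -/
structure IsStochasticInterpolant {d : ℕ} {Ω : Type*} [MeasurableSpace Ω] (P : Measure Ω)
    (ν : Measure (Rd d × Rd d)) (I : ℝ → Rd d → Rd d → Rd d) (γ : ℝ → ℝ) (X₀ X₁ Z : Ω → Rd d)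
    (h : Rd d × Rd d → ℝ) : Prop where
  map : IsInterpolationMap I
  scale : IsLatentScale γ
  sample : IsSample P ν X₀ X₁ Z
  weight : IsDominatedWeight (Icc 0 1) (fun t (q : Rd d × Rd d) => dtI I t q.1 q.2) h
  integrable_bound : Integrable h ν
  memLp : ∀ t ∈ Icc (0 : ℝ) 1, MemLp (fun q : Rd d × Rd d => dtI I t q.1 q.2) 2 ν

/-! ### Law, moments and path regularity of the interpolant -/

namespace IsStochasticInterpolant

variable {d : ℕ} {Ω : Type*} [MeasurableSpace Ω] {P : Measure Ω}
    {ν : Measure (Rd d × Rd d)} {I : ℝ → Rd d → Rd d → Rd d} {γ : ℝ → ℝ} {X₀ X₁ Z : Ω → Rd d}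
    {h : Rd d × Rd d → ℝ} {t : ℝ}

lemma measurable_pair (H : IsStochasticInterpolant P ν I γ X₀ X₁ Z h) :
    Measurable fun w => (X₀ w, X₁ w) :=
  H.sample.measurable_fst.prodMk H.sample.measurable_snd

lemma law [IsProbabilityMeasure P]
    (H : IsStochasticInterpolant P ν I γ X₀ X₁ Z h) :
    P.map (fun w => ((X₀ w, X₁ w), Z w)) = ν.prod (stdGaussian (Rd d)) := by
  have h1 := (indepFun_iff_map_prod_eq_prod_map_map H.measurable_pair.aemeasurable
    H.sample.measurable_latent.aemeasurable).1 H.sample.indep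
  rw [h1, H.sample.law_pair, H.sample.law_latent]

lemma isProbabilityMeasure [IsProbabilityMeasure P]
    (H : IsStochasticInterpolant P ν I γ X₀ X₁ Z h) :
    IsProbabilityMeasure ν := by
  rw [← H.sample.law_pair]
  exact Measure.isProbabilityMeasure_map H.measurable_pair.aemeasurable

lemma integrable_bound_pair (H : IsStochasticInterpolant P ν I γ X₀ X₁ Z h) :
    Integrable (fun w => h (X₀ w, X₁ w)) P := by
  have h1 := H.integrable_bound
  rw [← H.sample.law_pair] at h1
  exact h1.comp_measurable H.measurable_pair

lemma memLp_latent (H : IsStochasticInterpolant P ν I γ X₀ X₁ Z h) : MemLp Z 2 P := by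
  have h1 : MemLp id 2 (P.map Z) := by
    rw [H.sample.law_latent]
    exact IsGaussian.memLp_two_id
  exact h1.comp_of_map H.sample.measurable_latent.aemeasurable

lemma integral_latent (H : IsStochasticInterpolant P ν I γ X₀ X₁ Z h) : ∫ w, Z w ∂P = 0 := by
  have h1 := integral_map (μ := P) H.sample.measurable_latent.aemeasurable
    (f := fun z : Rd d => z) measurable_id.aestronglyMeasurable
  rw [← h1, H.sample.law_latent, integral_id_stdGaussian]

lemma memLp_dtI (H : IsStochasticInterpolant P ν I γ X₀ X₁ Z h) (ht : t ∈ Icc (0 : ℝ) 1) :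
    MemLp (fun w => dtI I t (X₀ w) (X₁ w)) 2 P := by
  have h1 := H.memLp t ht
  rw [← H.sample.law_pair] at h1
  exact h1.comp_of_map H.measurable_pair.aemeasurable

lemma measurable_dtI (H : IsStochasticInterpolant P ν I γ X₀ X₁ Z h) (ht : t ∈ Icc (0 : ℝ) 1) :
    Measurable fun w => dtI I t (X₀ w) (X₁ w) :=
  (H.map.measurable_dtI ht).comp H.measurable_pair

lemma memLp_processVelocity (H : IsStochasticInterpolant P ν I γ X₀ X₁ Z h)
    (ht : t ∈ Icc (0 : ℝ) 1) : MemLp (processVelocity I γ X₀ X₁ Z t) 2 P :=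
  (H.memLp_dtI ht).add (H.memLp_latent.const_smul (derivWithin γ (Icc 0 1) t))

lemma measurable_process (H : IsStochasticInterpolant P ν I γ X₀ X₁ Z h)
    (ht : t ∈ Icc (0 : ℝ) 1) : Measurable (process I γ X₀ X₁ Z t) :=
  ((H.map.measurable ht).comp H.measurable_pair).add
    (H.sample.measurable_latent.const_smul (γ t))

lemma continuousOn_process (H : IsStochasticInterpolant P ν I γ X₀ X₁ Z h) (w : Ω) :
    ContinuousOn (fun t => process I γ X₀ X₁ Z t w) (Icc 0 1) :=
  (H.map.contDiff_time (X₀ w) (X₁ w)).continuousOn.add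
    (H.scale.continuousOn.smul continuousOn_const)

lemma hasDerivAt_process (H : IsStochasticInterpolant P ν I γ X₀ X₁ Z h) (ht : t ∈ Ioo (0 : ℝ) 1)
    (w : Ω) : HasDerivAt (fun t => process I γ X₀ X₁ Z t w) (processVelocity I γ X₀ X₁ Z t w) t :=
  (H.map.hasDerivAt ht (X₀ w) (X₁ w)).add ((H.scale.hasDerivAt ht).smul_const (Z w))

lemma continuousOn_integral_comp_process [IsProbabilityMeasure P]
    (H : IsStochasticInterpolant P ν I γ X₀ X₁ Z h)
    {f : Rd d → ℝ} (hf : Continuous f) (hc : HasCompactSupport f) :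
    ContinuousOn (fun t => ∫ w, f (process I γ X₀ X₁ Z t w) ∂P) (Icc 0 1) := by
  obtain ⟨C, hC⟩ := hf.bounded_above_of_compact_support hc
  exact continuousOn_of_dominated (bound := fun _ => C)
    (fun t ht => (hf.measurable.comp (H.measurable_process ht)).aestronglyMeasurable)
    (fun t _ => ae_of_all _ fun w => hC _) (integrable_const _)
    (ae_of_all _ fun w => hf.comp_continuousOn (H.continuousOn_process w))

end IsStochasticInterpolant

/-- `E[ψ(x_t) · ∂ₜI] + (1/2) (γ²)'(t) E[div ψ(x_t)]`, the flux of the interpolant tested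
against `ψ`. -/
def fluxPairing {d : ℕ} {Ω : Type*} [MeasurableSpace Ω] (P : Measure Ω)
    (I : ℝ → Rd d → Rd d → Rd d) (γ : ℝ → ℝ) (X₀ X₁ Z : Ω → Rd d) (ψ : Rd d → Rd d) (t : ℝ) : ℝ :=
  (∫ w, inner ℝ (ψ (process I γ X₀ X₁ Z t w)) (dtI I t (X₀ w) (X₁ w)) ∂P) +
    1 / 2 * derivWithin (fun s => γ s ^ 2) (Icc 0 1) t *
      ∫ w, divergence ψ (process I γ X₀ X₁ Z t w) ∂P

/-! ### The flux tested against functions, up to the endpoints -/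

namespace IsStochasticInterpolant

variable {d : ℕ} {Ω : Type*} [MeasurableSpace Ω] {P : Measure Ω}
    {ν : Measure (Rd d × Rd d)} {I : ℝ → Rd d → Rd d → Rd d} {γ : ℝ → ℝ} {X₀ X₁ Z : Ω → Rd d}
    {h : Rd d × Rd d → ℝ} {t : ℝ} {ψ : Rd d → Rd d}

/-- Dominated convergence works on the closed interval because `γ'` does not occur, only `∂ₜI` and
`(γ²)'`. -/
lemma continuousOn_fluxPairing [IsProbabilityMeasure P]
    (H : IsStochasticInterpolant P ν I γ X₀ X₁ Z h)
    (hψ : ContDiff ℝ 1 ψ) (hc : HasCompactSupport ψ) :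
    ContinuousOn (fluxPairing P I γ X₀ X₁ Z ψ) (Icc 0 1) := by
  obtain ⟨C, hC⟩ := hψ.continuous.bounded_above_of_compact_support hc
  refine ContinuousOn.add ?_ ((H.scale.continuousOn_derivWithin_sq.const_mul _).mul
    (H.continuousOn_integral_comp_process (continuous_divergence hψ)
      (hasCompactSupport_divergence hc)))
  refine continuousOn_of_dominated (bound := fun w => C * h (X₀ w, X₁ w)) (fun t ht => ?_)
    (fun t ht => ae_of_all _ fun w => ?_) (H.integrable_bound_pair.const_mul C)
    (ae_of_all _ fun w => ?_)
  · exact ((hψ.continuous.measurable.comp (H.measurable_process ht)).inner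
      (H.measurable_dtI ht)).aestronglyMeasurable
  · exact (norm_inner_le_norm _ _).trans (mul_le_mul (hC _) (H.weight.norm_le t ht (X₀ w, X₁ w))
      (norm_nonneg _) ((norm_nonneg _).trans (hC 0)))
  · exact (hψ.continuous.comp_continuousOn (H.continuousOn_process w)).inner
      (H.map.continuousOn_dtI (X₀ w) (X₁ w))

lemma integrable_inner_process (H : IsStochasticInterpolant P ν I γ X₀ X₁ Z h)
    (ht : t ∈ Icc (0 : ℝ) 1) (hψ : Continuous ψ) (hc : HasCompactSupport ψ) {Y : Ω → Rd d}
    (hY : Integrable Y P) :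
    Integrable (fun w => inner ℝ (ψ (process I γ X₀ X₁ Z t w)) (Y w)) P := by
  obtain ⟨C, hC⟩ := hψ.bounded_above_of_compact_support hc
  refine (hY.norm.const_mul C).mono' ?_ (ae_of_all _ fun w => (norm_inner_le_norm _ _).trans
    (mul_le_mul_of_nonneg_right (hC _) (norm_nonneg _)))
  exact ((hψ.measurable.comp (H.measurable_process ht)).aestronglyMeasurable).inner
    hY.aestronglyMeasurable

/-- By independence, Stein's identity applies in `z` for each frozen `(x₀, x₁)`; Fubini then
averages. -/
lemma integral_inner_latent [IsProbabilityMeasure P]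
    (H : IsStochasticInterpolant P ν I γ X₀ X₁ Z h)
    (ht : t ∈ Ioo (0 : ℝ) 1) (hψ : ContDiff ℝ 1 ψ) (hc : HasCompactSupport ψ) :
    ∫ w, inner ℝ (ψ (process I γ X₀ X₁ Z t w)) (Z w) ∂P =
      γ t * ∫ w, divergence ψ (process I γ X₀ X₁ Z t w) ∂P := by
  have ht' := Ioo_subset_Icc_self ht
  have hν := H.isProbabilityMeasure
  have hpair : Measurable fun w => ((X₀ w, X₁ w), Z w) :=
    H.measurable_pair.prodMk H.sample.measurable_latent
  have mI := H.map.measurable ht'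
  have mT : Measurable fun p : (Rd d × Rd d) × Rd d => I t p.1.1 p.1.2 + γ t • p.2 :=
    (mI.comp measurable_fst).add (measurable_snd.const_smul (γ t))
  have m1 : Measurable fun p : (Rd d × Rd d) × Rd d =>
      (inner ℝ (ψ (I t p.1.1 p.1.2 + γ t • p.2)) p.2 : ℝ) :=
    (hψ.continuous.measurable.comp mT).inner measurable_snd
  have m2 : Measurable fun p : (Rd d × Rd d) × Rd d =>
      divergence ψ (I t p.1.1 p.1.2 + γ t • p.2) :=
    (continuous_divergence hψ).measurable.comp mT
  have e1 := integral_map (μ := P) hpair.aemeasurable m1.aestronglyMeasurable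
  have e2 := integral_map (μ := P) hpair.aemeasurable m2.aestronglyMeasurable
  have i1 : Integrable (fun p : (Rd d × Rd d) × Rd d =>
      (inner ℝ (ψ (I t p.1.1 p.1.2 + γ t • p.2)) p.2 : ℝ)) (ν.prod (stdGaussian (Rd d))) := by
    rw [← H.law, integrable_map_measure m1.aestronglyMeasurable hpair.aemeasurable]
    exact H.integrable_inner_process ht' hψ.continuous hc (H.memLp_latent.integrable (by norm_num))
  have i2 : Integrable (fun p : (Rd d × Rd d) × Rd d =>
      divergence ψ (I t p.1.1 p.1.2 + γ t • p.2)) (ν.prod (stdGaussian (Rd d))) := by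
    obtain ⟨C, hC⟩ := (continuous_divergence hψ).bounded_above_of_compact_support
      (hasCompactSupport_divergence hc)
    exact (integrable_const C).mono' m2.aestronglyMeasurable (ae_of_all _ fun p => hC _)
  rw [H.law, integral_prod _ i1] at e1
  rw [H.law, integral_prod _ i2] at e2
  unfold process
  rw [← e1, ← e2, ← integral_const_mul]
  refine integral_congr_ae (ae_of_all _ fun q => ?_)
  simp only
  exact integral_inner_stdGaussian hψ hc (I t q.1 q.2) (H.scale.pos t ht).ne'

lemma integral_inner_processVelocity [IsProbabilityMeasure P]
    (H : IsStochasticInterpolant P ν I γ X₀ X₁ Z h)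
    (ht : t ∈ Ioo (0 : ℝ) 1) (hψ : ContDiff ℝ 1 ψ) (hc : HasCompactSupport ψ) :
    ∫ w, inner ℝ (ψ (process I γ X₀ X₁ Z t w)) (processVelocity I γ X₀ X₁ Z t w) ∂P =
      fluxPairing P I γ X₀ X₁ Z ψ t := by
  have ht' := Ioo_subset_Icc_self ht
  rw [fluxPairing, ← H.scale.mul_derivWithin ht, mul_assoc, ← H.integral_inner_latent ht hψ hc,
    ← integral_const_mul, ← integral_add]
  · simp only [processVelocity, inner_add_right, inner_smul_right]
  · exact H.integrable_inner_process ht' hψ.continuous hc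
      ((H.memLp_dtI ht').integrable (by norm_num))
  · exact (H.integrable_inner_process ht' hψ.continuous hc
      (H.memLp_latent.integrable (by norm_num))).const_mul _

lemma contDiff_gradient {φ : Rd d → ℝ} (hφ : ContDiff ℝ ∞ φ) : ContDiff ℝ ∞ (∇ φ) :=
  (InnerProductSpace.toDual ℝ (Rd d)).symm.contDiff.comp (hφ.fderiv_right (by simp))

lemma hasCompactSupport_gradient {φ : Rd d → ℝ} (hφ : HasCompactSupport φ) :
    HasCompactSupport (∇ φ) :=
  (hφ.fderiv ℝ).comp_left (map_zero (InnerProductSpace.toDual ℝ (Rd d)).symm)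

lemma hasDerivAt_integral_comp_process [IsProbabilityMeasure P]
    (H : IsStochasticInterpolant P ν I γ X₀ X₁ Z h)
    (ht : t ∈ Ioo (0 : ℝ) 1) {φ : Rd d → ℝ} (hφ : ContDiff ℝ ∞ φ) (hc : HasCompactSupport φ) :
    HasDerivAt (fun s => ∫ w, φ (process I γ X₀ X₁ Z s w) ∂P)
      (∫ w, inner ℝ (∇ φ (process I γ X₀ X₁ Z t w)) (processVelocity I γ X₀ X₁ Z t w) ∂P) t := by
  have hS : Ioo (0 : ℝ) 1 ∈ nhds t := isOpen_Ioo.mem_nhds ht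
  have hg := (contDiff_gradient hφ).continuous
  have hgc := hasCompactSupport_gradient hc
  obtain ⟨C, hC⟩ := hg.bounded_above_of_compact_support hgc
  have hΓ := (H.scale.continuousOn_derivWithin.continuousAt hS).norm.eventually
    (gt_mem_nhds (lt_add_one _))
  -- A bound for `γ'` valid near `t` by continuity at interior times.
  set Γ := ‖derivWithin γ (Icc 0 1) t‖ + 1
  have hm : ∀ s ∈ Icc (0 : ℝ) 1, AEStronglyMeasurable (fun w => φ (process I γ X₀ X₁ Z s w)) P :=
    fun s hs => (hφ.continuous.measurable.comp (H.measurable_process hs)).aestronglyMeasurable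
  refine (hasDerivAt_integral_of_dominated_loc_of_deriv_le
    (F' := fun s w => inner ℝ (∇ φ (process I γ X₀ X₁ Z s w)) (processVelocity I γ X₀ X₁ Z s w))
    (bound := fun w => C * (h (X₀ w, X₁ w) + Γ * ‖Z w‖)) (Filter.inter_mem hS hΓ)
    ?_ ?_ ?_ ?_ ?_ ?_).2
  · filter_upwards [hS] with s hs using hm s (Ioo_subset_Icc_self hs)
  · obtain ⟨C', hC'⟩ := hφ.continuous.bounded_above_of_compact_support hc
    exact (integrable_const C').mono' (hm t (Ioo_subset_Icc_self ht)) (ae_of_all _ fun w => hC' _)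
  · exact (H.integrable_inner_process (Ioo_subset_Icc_self ht) hg hgc
      ((H.memLp_processVelocity (Ioo_subset_Icc_self ht)).integrable
        (by norm_num))).aestronglyMeasurable
  · refine ae_of_all _ fun w s hs => (norm_inner_le_norm _ _).trans (mul_le_mul (hC _)
      ((norm_add_le _ _).trans (add_le_add (H.weight.norm_le s (Ioo_subset_Icc_self hs.1)
        (X₀ w, X₁ w)) ?_)) (norm_nonneg _) ((norm_nonneg _).trans (hC 0)))
    rw [norm_smul]
    exact mul_le_mul_of_nonneg_right (le_of_lt hs.2) (norm_nonneg _)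
  · exact (H.integrable_bound_pair.add
      ((H.memLp_latent.integrable (by norm_num)).norm.const_mul _)).const_mul _
  · refine ae_of_all _ fun w s hs => ?_
    refine ((hφ.differentiable (by simp) _).hasFDerivAt.comp_hasDerivAt s
      (H.hasDerivAt_process hs.1 w)).congr_deriv ?_
    rw [gradient, InnerProductSpace.toDual_symm_apply]

/-- In the interior the derivative is the tested flux, which equals `fluxPairing`; the latter is its
continuous extension to `[0,1]`. -/
lemma hasDerivWithinAt_integral_comp_process [IsProbabilityMeasure P]
    (H : IsStochasticInterpolant P ν I γ X₀ X₁ Z h)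
    (ht : t ∈ Icc (0 : ℝ) 1) {φ : Rd d → ℝ} (hφ : ContDiff ℝ ∞ φ) (hc : HasCompactSupport φ) :
    HasDerivWithinAt (fun s => ∫ w, φ (process I γ X₀ X₁ Z s w) ∂P)
      (fluxPairing P I γ X₀ X₁ Z (∇ φ) t) (Icc 0 1) t := by
  have hg := (contDiff_gradient hφ).of_le (m := 1) (by simp)
  have hgc := hasCompactSupport_gradient hc
  refine hasDerivWithinAt_Icc_of_hasDerivAt_Ioo
    (H.continuousOn_integral_comp_process hφ.continuous hc) (H.continuousOn_fluxPairing hg hgc)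
    (fun s hs => ?_) ht
  rw [← H.integral_inner_processVelocity hs hg hgc]
  exact H.hasDerivAt_integral_comp_process hs hφ hc

end IsStochasticInterpolant

/-! ### Transfer of expectations to integrals against the density -/

section DensityPairing

variable {d : ℕ} {Ω : Type*} [MeasurableSpace Ω] {P : Measure Ω} {X Y : Ω → Rd d}
  {f : Rd d → Rd d} {ρ : Rd d → ℝ}

lemma integral_comp_eq_integral_mul {φ : Rd d → ℝ} (hφ : Continuous φ) (hX : Measurable X)
    (hlaw : P.map X = densityMeasure ρ) (hρ : Measurable ρ) (h0 : ∀ x, 0 ≤ ρ x) :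
    ∫ w, φ (X w) ∂P = ∫ x, φ x * ρ x := by
  rw [← integral_map hX.aemeasurable hφ.aestronglyMeasurable, hlaw,
    integral_densityMeasure hρ h0]
  simp_rw [smul_eq_mul, mul_comm]

lemma integrable_comp_iff_integrable_mul {φ : Rd d → ℝ} (hφ : Measurable φ) (hX : Measurable X)
    (hlaw : P.map X = densityMeasure ρ) (hρ : Measurable ρ) (h0 : ∀ x, 0 ≤ ρ x) :
    Integrable (fun w => φ (X w)) P ↔ Integrable fun x => φ x * ρ x := by
  have h1 := integrable_map_measure (μ := P) (f := X) hφ.aestronglyMeasurable hX.aemeasurable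
  rw [hlaw, integrable_densityMeasure_iff hρ h0] at h1
  simp_rw [smul_eq_mul, mul_comm (ρ _)] at h1
  exact h1.symm

lemma IsCondExpGiven.integral_inner_mul [IsFiniteMeasure P] (h : IsCondExpGiven P Y X f)
    (hX : Measurable X) (hlaw : P.map X = densityMeasure ρ) (hρ : Measurable ρ)
    (h0 : ∀ x, 0 ≤ ρ x) {ψ : Rd d → Rd d} (hψ : Continuous ψ) (hc : HasCompactSupport ψ) :
    ∫ x, inner ℝ (ψ x) (f x) * ρ x = ∫ w, inner ℝ (ψ (X w)) (Y w) ∂P := by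
  obtain ⟨C, hC⟩ := hψ.bounded_above_of_compact_support hc
  have hm : Measurable fun x => (inner ℝ (ψ x) (f x) : ℝ) := hψ.measurable.inner h.2.1
  rw [← h.integral_inner hX hψ hC, ← integral_map (f := fun x => (inner ℝ (ψ x) (f x) : ℝ))
    hX.aemeasurable hm.aestronglyMeasurable, hlaw, integral_densityMeasure hρ h0]
  simp_rw [smul_eq_mul, mul_comm]

lemma IsCondExpGiven.integrable_inner_mul (h : IsCondExpGiven P Y X f)
    (hX : Measurable X) (hlaw : P.map X = densityMeasure ρ) (hρ : Measurable ρ)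
    (h0 : ∀ x, 0 ≤ ρ x) {ψ : Rd d → Rd d} (hψ : Continuous ψ) (hc : HasCompactSupport ψ) :
    Integrable fun x => inner ℝ (ψ x) (f x) * ρ x := by
  obtain ⟨C, hC⟩ := hψ.bounded_above_of_compact_support hc
  have hm : Measurable fun x => (inner ℝ (ψ x) (f x) : ℝ) := hψ.measurable.inner h.2.1
  rw [← integrable_comp_iff_integrable_mul hm hX hlaw hρ h0]
  exact (h.integrable_comp.norm.const_mul C).mono' (hm.comp hX).aestronglyMeasurable
    (ae_of_all _ fun w => (norm_inner_le_norm _ _).trans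
      (mul_le_mul_of_nonneg_right (hC _) (norm_nonneg _)))

lemma IsCondExpGiven.integrable_norm_sq_mul [IsFiniteMeasure P] (h : IsCondExpGiven P Y X f)
    (hY : MemLp Y 2 P) (hX : Measurable X) (hlaw : P.map X = densityMeasure ρ)
    (hρ : Measurable ρ) (h0 : ∀ x, 0 ≤ ρ x) : Integrable fun x => ‖f x‖ ^ 2 * ρ x :=
  (integrable_comp_iff_integrable_mul (h.2.1.norm.pow_const 2) hX hlaw hρ h0).1
    (h.integrable_norm_sq hY)

end DensityPairing

/-! ### The score `∇ log ρ` of a regular density -/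

section Score

variable {d : ℕ} {ρ : Rd d → ℝ}

lemma IsRegularDensity.gradient_log (hρ : IsRegularDensity ρ) (x : Rd d) :
    ∇ (fun y => Real.log (ρ y)) x = (ρ x)⁻¹ • ∇ ρ x := by
  have h1 : HasFDerivAt (fun y => Real.log (ρ y)) ((ρ x)⁻¹ • fderiv ℝ ρ x) x :=
    (hρ.contDiff.differentiable (by norm_num) x).hasFDerivAt.log (hρ.pos x).ne'
  rw [gradient, gradient, h1.fderiv, map_smul]

lemma IsRegularDensity.continuous_gradient_log (hρ : IsRegularDensity ρ) :
    Continuous (∇ fun y => Real.log (ρ y)) := by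
  have h1 : (∇ fun y => Real.log (ρ y)) = fun x => (ρ x)⁻¹ • ∇ ρ x :=
    funext hρ.gradient_log
  rw [h1]
  exact (hρ.contDiff.continuous.inv₀ fun x => (hρ.pos x).ne').smul
    ((InnerProductSpace.toDual ℝ (Rd d)).symm.continuous.comp
      (hρ.contDiff.continuous_fderiv (by norm_num)))

lemma IsRegularDensity.inner_gradient_log_mul (hρ : IsRegularDensity ρ) (v x : Rd d) :
    inner ℝ v (∇ (fun y => Real.log (ρ y)) x) * ρ x = fderiv ℝ ρ x v := by
  rw [hρ.gradient_log, inner_smul_right, real_inner_comm, gradient,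
    InnerProductSpace.toDual_symm_apply, mul_comm, ← mul_assoc, mul_inv_cancel₀ (hρ.pos x).ne',
    one_mul]

end Score

lemma MemC1Cp.congr {d : ℕ} {F : Type*} [NormedAddCommGroup F] [NormedSpace ℝ F] {S : Set ℝ}
    {p : ℕ} {u v : ℝ → Rd d → F} (hu : MemC1Cp S p u) (h : ∀ t ∈ S, v t = u t) :
    MemC1Cp S p v := by
  have h0 : ∀ x, ∀ t ∈ S, v t x = u t x := fun x t ht => congrFun (h t ht) x
  refine ⟨⟨fun t ht => by rw [h t ht]; exact hu.1.1 t ht, fun n hn =>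
    (hu.1.2 n hn).congr fun q hq => by simp only [h q.1 hq.1]⟩, ?_,
    fun x => (hu.2.2 x).congr (h0 x)⟩
  have h1 : ∀ t ∈ S, (fun x => derivWithin (fun s => v s x) S t) =
      fun x => derivWithin (fun s => u s x) S t := fun t ht =>
    funext fun x => derivWithin_congr (h0 x) (h0 x t ht)
  exact ⟨fun t ht => by simp only [h1 t ht]; exact hu.2.1.1 t ht, fun n hn =>
    (hu.2.1.2 n hn).congr fun q hq => by simp only [h1 q.1 hq.1]⟩

/-- The score correction is forced: its pairing with `ψ ρ` is, after integration by parts, the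
divergence term of `fluxPairing`. -/
lemma IsStochasticInterpolant.exists_endpoint_velocity {d : ℕ} {Ω : Type*} [MeasurableSpace Ω]
    {P : Measure Ω} [IsProbabilityMeasure P] {ν : Measure (Rd d × Rd d)}
    {I : ℝ → Rd d → Rd d → Rd d} {γ : ℝ → ℝ} {X₀ X₁ Z : Ω → Rd d} {h : Rd d × Rd d → ℝ} {t : ℝ}
    {ρ : Rd d → ℝ} (H : IsStochasticInterpolant P ν I γ X₀ X₁ Z h) (ht : t ∈ Icc (0 : ℝ) 1)
    (h0 : γ t = 0) (hρ : IsRegularDensity ρ)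
    (hlaw : P.map (process I γ X₀ X₁ Z t) = densityMeasure ρ) :
    ∃ b : Rd d → Rd d,
      (DifferentiableWithinAt ℝ γ (Icc 0 1) t →
        IsCondExpGiven P (processVelocity I γ X₀ X₁ Z t) (process I γ X₀ X₁ Z t) b) ∧
      (∃ c : Rd d → Rd d,
        IsCondExpGiven P (fun w => dtI I t (X₀ w) (X₁ w)) (process I γ X₀ X₁ Z t) c ∧
        ∀ x, b x = c x - ((1 / 2 : ℝ) * derivWithin (fun s => γ s ^ 2) (Icc 0 1) t) •
          ∇ (fun y => Real.log (ρ y)) x) ∧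
      (∀ ψ : Rd d → Rd d, ContDiff ℝ ∞ ψ → HasCompactSupport ψ →
        ∫ x, inner ℝ (ψ x) (b x) * ρ x = fluxPairing P I γ X₀ X₁ Z ψ t) ∧
      Integrable fun x => ‖b x‖ ^ 2 * ρ x := by
  have hX := H.measurable_process ht
  have hpos : ∀ x, 0 ≤ ρ x := fun x => (hρ.pos x).le
  have hρm := hρ.contDiff.continuous.measurable
  obtain ⟨c, hc⟩ := exists_isCondExpGiven (process I γ X₀ X₁ Z t)
    ((H.memLp_dtI ht).integrable (by norm_num))
  set a : ℝ := (1 / 2 : ℝ) * derivWithin (fun s => γ s ^ 2) (Icc 0 1) t with ha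
  refine ⟨fun x => c x - a • ∇ (fun y => Real.log (ρ y)) x, fun hd => ?_, ⟨c, hc, fun x => rfl⟩,
    fun ψ hψ hψc => ?_, ?_⟩
  -- If `γ` is differentiable here, `(γ²)' = 2 γ γ' = 0`, so the correction vanishes. Moreover `x_t`
  -- depends on `(x₀, x₁)` only and is independent of the latent variable, so adding `γ' z` changes
  -- nothing.
  · have ha0 : a = 0 := by
      rw [ha, derivWithin_sq_of_differentiableWithinAt ht hd, h0]; simp
    simp only [ha0, zero_smul, sub_zero]
    have hind : IndepFun (process I γ X₀ X₁ Z t) Z P := by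
      have h1 : process I γ X₀ X₁ Z t =
          (fun q : Rd d × Rd d => I t q.1 q.2) ∘ fun w => (X₀ w, X₁ w) := by
        ext1 w; simp [process, h0]
      rw [h1]
      exact H.sample.indep.comp (H.map.measurable ht) measurable_id
    exact hc.add_smul_of_indepFun hX H.sample.measurable_latent
      (H.memLp_latent.integrable (by norm_num)) H.integral_latent hind _
  · have hψ1 : ContDiff ℝ 1 ψ := hψ.of_le (by simp)
    have hρ1 : ContDiff ℝ 1 ρ := hρ.contDiff.of_le (by norm_num)
    have e1 : ∀ x, inner ℝ (ψ x) (c x - a • ∇ (fun y => Real.log (ρ y)) x) * ρ x =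
        inner ℝ (ψ x) (c x) * ρ x - a * fderiv ℝ ρ x (ψ x) := fun x => by
      rw [inner_sub_right, inner_smul_right, sub_mul, mul_assoc, hρ.inner_gradient_log_mul]
    have i1 : Integrable fun x => fderiv ℝ ρ x (ψ x) := by
      refine Continuous.integrable_of_hasCompactSupport ?_ ?_
      · have := hρ1.continuous_fderiv (by norm_num)
        have := hψ.continuous
        fun_prop
      · refine hψc.mono fun x hx => ?_
        contrapose! hx
        simp [Function.notMem_support.1 hx]
    simp_rw [e1]
    rw [integral_sub (hc.integrable_inner_mul hX hlaw hρm hpos hψ.continuous hψc)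
      (i1.const_mul a), integral_const_mul, hc.integral_inner_mul hX hlaw hρm hpos hψ.continuous
      hψc, integral_fderiv_apply_eq_neg_integral_divergence hψ1 hψc hρ1, fluxPairing,
      integral_comp_eq_integral_mul (continuous_divergence hψ1) hX hlaw hρm hpos]
    simp_rw [mul_comm (ρ _)]
    ring
  · have i1 := hc.integrable_norm_sq_mul (H.memLp_dtI ht) hX hlaw hρm hpos
    have hm : Measurable fun x => c x - a • ∇ (fun y => Real.log (ρ y)) x :=
      hc.2.1.sub (hρ.continuous_gradient_log.measurable.const_smul a)
    refine ((i1.const_mul 2).add (hρ.fisher.const_mul (2 * a ^ 2))).mono'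
      ((hm.norm.pow_const 2).mul hρm).aestronglyMeasurable (ae_of_all _ fun x => ?_)
    rw [Real.norm_of_nonneg (mul_nonneg (sq_nonneg _) (hpos x))]
    set s := ∇ (fun y => Real.log (ρ y)) x
    -- Splits the integrand into a conditional second moment and the Fisher information.
    have h2 : ‖c x - a • s‖ ^ 2 ≤ 2 * ‖c x‖ ^ 2 + 2 * a ^ 2 * ‖s‖ ^ 2 := by
      have h3 := norm_sub_le (c x) (a • s)
      have h4 : ‖a • s‖ ^ 2 = a ^ 2 * ‖s‖ ^ 2 := by rw [norm_smul, mul_pow]; simp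
      nlinarith [sq_nonneg (‖c x‖ - ‖a • s‖), norm_nonneg (c x - a • s)]
    calc ‖c x - a • s‖ ^ 2 * ρ x ≤ (2 * ‖c x‖ ^ 2 + 2 * a ^ 2 * ‖s‖ ^ 2) * ρ x :=
          mul_le_mul_of_nonneg_right h2 (hpos x)
      _ = _ := by simp only [Pi.add_apply]; ring

end

end Interpolant

/-! ### Gluing the interior and endpoint constructions -/

theorem mainTheorem1 {d : ℕ} {Ω : Type*} [MeasurableSpace Ω] (P : Measure Ω)
    [IsProbabilityMeasure P] (ρ₀ ρ₁ : Rd d → ℝ) (I : ℝ → Rd d → Rd d → Rd d) (γ : ℝ → ℝ)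
    (ν : Measure (Rd d × Rd d)) (X₀ X₁ Z : Ω → Rd d)
    (hρ₀ : Interpolant.IsProbDensity ρ₀) (hρ₁ : Interpolant.IsProbDensity ρ₁)
    (hI : Interpolant.IsInterpolationMap I) (hγ : Interpolant.IsLatentScale γ)
    (hν : Interpolant.IsCoupling ν ρ₀ ρ₁) (hX : Interpolant.IsSample P ν X₀ X₁ Z)
    (hρ₀' : Interpolant.IsRegularDensity ρ₀) (hρ₁' : Interpolant.IsRegularDensity ρ₁)
    (hM : Interpolant.HasMomentBounds ν I) :
    (∀ t ∈ Icc (0 : ℝ) 1, P.map (Interpolant.process I γ X₀ X₁ Z t) ≪ volume) ∧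
    ∃ (ρ : ℝ → Rd d → ℝ) (b : ℝ → Rd d → Rd d),
      -- `ρ(t)` is the density of `x_t`
      (∀ t ∈ Icc (0 : ℝ) 1,
        P.map (Interpolant.process I γ X₀ X₁ Z t) = Interpolant.densityMeasure (ρ t)) ∧
      ρ 0 = ρ₀ ∧ ρ 1 = ρ₁ ∧
      (∀ t ∈ Icc (0 : ℝ) 1, ∀ x, 0 < ρ t x) ∧
      (∀ p : ℕ, Interpolant.MemC1Cp (Ioo 0 1) p ρ) ∧
      -- `b(t, x) = E[∂ₜI + γ' z | x_t = x]` wherever `γ'(t)` exists, in particular on `(0,1)`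
      (∀ t ∈ Ioo (0 : ℝ) 1, DifferentiableAt ℝ γ t) ∧
      (∀ t ∈ Icc (0 : ℝ) 1, DifferentiableWithinAt ℝ γ (Icc 0 1) t →
        Interpolant.IsCondExpGiven P (Interpolant.processVelocity I γ X₀ X₁ Z t)
          (Interpolant.process I γ X₀ X₁ Z t) (b t)) ∧
      -- at the endpoints, `b = E[∂ₜI | x_t = x] - (1/2) (γ²)' ∇ log ρ`
      (∀ t : ℝ, t = 0 ∨ t = 1 →
        ∃ c : Rd d → Rd d,
          Interpolant.IsCondExpGiven P (fun w => Interpolant.dtI I t (X₀ w) (X₁ w))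
            (Interpolant.process I γ X₀ X₁ Z t) c ∧
          ∀ x, b t x = c x - ((1 / 2 : ℝ) * derivWithin (fun s => γ s ^ 2) (Icc 0 1) t) •
            ∇ (fun y => Real.log (ρ t y)) x) ∧
      -- the transport equation, pointwise on `(0,1)`
      (∀ t ∈ Ioo (0 : ℝ) 1, ∀ x,
        deriv (fun s => ρ s x) t + Interpolant.divergence (fun y => ρ t y • b t y) x = 0) ∧
      -- the transport equation on the closed interval, tested against functions of `x`
      (∀ φ : Rd d → ℝ, ContDiff ℝ ∞ φ → HasCompactSupport φ →
        ∀ t ∈ Icc (0 : ℝ) 1,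
          HasDerivWithinAt (fun s => ∫ x, φ x * ρ s x)
            (∫ x, inner ℝ (∇ φ x) (b t x) * ρ t x) (Icc 0 1) t) ∧
      -- the velocity is smooth in `x`, continuously in `t`; its flux is weakly continuous on `[0,1]`
      (∀ p : ℕ, Interpolant.MemC0Cp (Ioo 0 1) p b) ∧
      (∀ ψ : Rd d → Rd d, ContDiff ℝ ∞ ψ → HasCompactSupport ψ →
        ContinuousOn (fun t => ∫ x, inner ℝ (ψ x) (b t x) * ρ t x) (Icc 0 1)) ∧
      -- square-integrability
      (∀ t ∈ Icc (0 : ℝ) 1, Integrable fun x => ‖b t x‖ ^ 2 * ρ t x) := by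
  have hν' : IsProbabilityMeasure ν := by
    rw [← hX.law_pair]
    exact Measure.isProbabilityMeasure_map
      (hX.measurable_fst.prodMk hX.measurable_snd).aemeasurable
  obtain ⟨h, hh, hw⟩ := hI.exists_integrable_bound hM
  have H : Interpolant.IsStochasticInterpolant P ν I γ X₀ X₁ Z h :=
    -- `L⁴ ⊆ L²` since `ν` is a probability measure.
    ⟨hI, hγ, hX, hw, hh, fun t ht => (hI.memLp_dtI hM ht).mono_exponent (by norm_num)⟩
  have hD := hI.isDifferentiablePath hγ hw
  have law_fst : P.map X₀ = Interpolant.densityMeasure ρ₀ := by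
    rw [← hν.fst_eq, ← hX.law_pair, Measure.map_map measurable_fst H.measurable_pair]
    rfl
  have law_snd : P.map X₁ = Interpolant.densityMeasure ρ₁ := by
    rw [← hν.snd_eq, ← hX.law_pair, Measure.map_map measurable_snd H.measurable_pair]
    rfl
  have law_zero : P.map (Interpolant.process I γ X₀ X₁ Z 0) = Interpolant.densityMeasure ρ₀ := by
    have e : Interpolant.process I γ X₀ X₁ Z 0 = X₀ := by
      ext1 w; simp [Interpolant.process, hI.at_zero, hγ.at_zero]
    rw [e, law_fst]
  have law_one : P.map (Interpolant.process I γ X₀ X₁ Z 1) = Interpolant.densityMeasure ρ₁ := by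
    have e : Interpolant.process I γ X₀ X₁ Z 1 = X₁ := by
      ext1 w; simp [Interpolant.process, hI.at_one, hγ.at_one]
    rw [e, law_snd]
  obtain ⟨b₀, hb₀, hb₀', hb₀p, hb₀i⟩ := H.exists_endpoint_velocity
    (left_mem_Icc.2 zero_le_one) hγ.at_zero hρ₀' law_zero
  obtain ⟨b₁, hb₁, hb₁', hb₁p, hb₁i⟩ := H.exists_endpoint_velocity
    (right_mem_Icc.2 zero_le_one) hγ.at_one hρ₁' law_one
  set σ := Interpolant.smoothedDensity ν (fun t (q : Rd d × Rd d) => I t q.1 q.2) γ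
  set j := Interpolant.smoothedFlux ν (fun t (q : Rd d × Rd d) => I t q.1 q.2)
    (fun t q => Interpolant.dtI I t q.1 q.2) γ (derivWithin γ (Icc 0 1))
  -- The smoothing formulas degenerate where `γ = 0`, so density and velocity are overwritten at `t
  -- = 0` and `t = 1`.
  obtain ⟨ρ, hρz, hρo, hρi⟩ : ∃ ρ : ℝ → Rd d → ℝ, ρ 0 = ρ₀ ∧ ρ 1 = ρ₁ ∧
      ∀ t ∈ Ioo (0 : ℝ) 1, ρ t = σ t :=
    ⟨Function.update (Function.update σ 0 ρ₀) 1 ρ₁, by simp, by simp, fun t ht => by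
      simp [Function.update_of_ne, ht.1.ne', ht.2.ne]⟩
  obtain ⟨b, hbz, hbo, hbi⟩ : ∃ b : ℝ → Rd d → Rd d, b 0 = b₀ ∧ b 1 = b₁ ∧
      ∀ t ∈ Ioo (0 : ℝ) 1, b t = fun x => (σ t x)⁻¹ • j t x :=
    ⟨Function.update (Function.update (fun t x => (σ t x)⁻¹ • j t x) 0 b₀) 1 b₁, by simp, by simp,
      fun t ht => by simp [Function.update_of_ne, ht.1.ne', ht.2.ne]⟩
  have hcases : ∀ t ∈ Icc (0 : ℝ) 1, t = 0 ∨ t = 1 ∨ t ∈ Ioo (0 : ℝ) 1 := fun t ht => by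
    rcases ht.1.eq_or_lt with h0 | h0
    · exact Or.inl h0.symm
    rcases ht.2.eq_or_lt with h1 | h1
    · exact Or.inr (Or.inl h1)
    · exact Or.inr (Or.inr ⟨h0, h1⟩)
  have hσpos : ∀ t ∈ Ioo (0 : ℝ) 1, ∀ x, 0 < σ t x := fun t ht x => hD.smoothedDensity_pos ht x
  have hpos : ∀ t ∈ Icc (0 : ℝ) 1, ∀ x, 0 < ρ t x := fun t ht x => by
    rcases hcases t ht with rfl | rfl | ht
    · rw [hρz]; exact hρ₀'.pos x
    · rw [hρo]; exact hρ₁'.pos x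
    · rw [hρi t ht]; exact hσpos t ht x
  have hmeas : ∀ t ∈ Icc (0 : ℝ) 1, Measurable (ρ t) := fun t ht => by
    rcases hcases t ht with rfl | rfl | ht
    · rw [hρz]; exact hρ₀.measurable
    · rw [hρo]; exact hρ₁.measurable
    · rw [hρi t ht]; exact ((hD.memC0Cp_smoothedDensity 0).1 t ht).continuous.measurable
  have hlaw : ∀ t ∈ Icc (0 : ℝ) 1, P.map (Interpolant.process I γ X₀ X₁ Z t) =
      Interpolant.densityMeasure (ρ t) := fun t ht => by
    rcases hcases t ht with rfl | rfl | ht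
    · rw [hρz, law_zero]
    · rw [hρo, law_one]
    · rw [hρi t ht]
      exact Interpolant.map_path_eq_densityMeasure H.measurable_pair hX.measurable_latent
        H.law hD ht
  have hce : ∀ t ∈ Ioo (0 : ℝ) 1, Interpolant.IsCondExpGiven P
      (Interpolant.processVelocity I γ X₀ X₁ Z t) (Interpolant.process I γ X₀ X₁ Z t) (b t) :=
    fun t ht => by
    rw [hbi t ht]
    exact hD.isCondExpGiven hh H.measurable_pair hX.measurable_latent H.law ht
      ((H.memLp_processVelocity (Ioo_subset_Icc_self ht)).integrable (by norm_num))
  -- One formula for interior and endpoint times alike; the weak equation and the weak continuity of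
  -- the flux both rest on it.
  have hpair : ∀ ψ : Rd d → Rd d, ContDiff ℝ ∞ ψ → HasCompactSupport ψ → ∀ t ∈ Icc (0 : ℝ) 1,
      ∫ x, inner ℝ (ψ x) (b t x) * ρ t x = Interpolant.fluxPairing P I γ X₀ X₁ Z ψ t :=
    fun ψ hψ hc t ht => by
    rcases hcases t ht with rfl | rfl | ht'
    · rw [hρz, hbz, hb₀p ψ hψ hc]
    · rw [hρo, hbo, hb₁p ψ hψ hc]
    · rw [(hce t ht').integral_inner_mul (H.measurable_process ht) (hlaw t ht) (hmeas t ht)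
        (fun x => (hpos t ht x).le) hψ.continuous hc]
      exact H.integral_inner_processVelocity ht' (hψ.of_le (by simp)) hc
  refine ⟨fun t ht => ?_, ρ, b, hlaw, hρz, hρo, hpos,
    fun p => (hD.memC1Cp_smoothedDensity hh p).congr hρi, fun t ht => hγ.differentiableAt ht,
    fun t ht hd => ?_, fun t ht => ?_, fun t ht x => ?_, fun φ hφ hc t ht => ?_, fun p => ?_,
    fun ψ hψ hc => ?_, fun t ht => ?_⟩
  · rw [hlaw t ht]
    exact withDensity_absolutelyContinuous _ _
  · rcases hcases t ht with rfl | rfl | ht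
    · rw [hbz]; exact hb₀ hd
    · rw [hbo]; exact hb₁ hd
    · exact hce t ht
  · rcases ht with rfl | rfl
    · rw [hρz, hbz]; exact hb₀'
    · rw [hρo, hbo]; exact hb₁'
  · have e1 : (fun s => ρ s x) =ᶠ[nhds t] fun s => σ s x := by
      filter_upwards [isOpen_Ioo.mem_nhds ht] with s hs
      rw [hρi s hs]
    have e2 : (fun y => ρ t y • b t y) = j t := by
      ext1 y
      rw [hρi t ht, hbi t ht, smul_smul, mul_inv_cancel₀ (hσpos t ht y).ne', one_smul]
    rw [e1.deriv_eq, (hD.hasDerivAt_smoothedDensity hh ht x).deriv, e2, neg_add_cancel]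
  · have e1 : ∀ s ∈ Icc (0 : ℝ) 1, ∫ x, φ x * ρ s x =
        ∫ w, φ (Interpolant.process I γ X₀ X₁ Z s w) ∂P := fun s hs =>
      (Interpolant.integral_comp_eq_integral_mul hφ.continuous (H.measurable_process hs)
        (hlaw s hs) (hmeas s hs) fun x => (hpos s hs x).le).symm
    rw [hpair _ (Interpolant.IsStochasticInterpolant.contDiff_gradient hφ)
      (Interpolant.IsStochasticInterpolant.hasCompactSupport_gradient hc) t ht]
    exact (H.hasDerivWithinAt_integral_comp_process ht hφ hc).congr e1 (e1 t ht)
  · exact (((hD.memC0Cp_smoothedDensity p).inv fun t ht x => (hσpos t ht x).ne').smul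
      (hD.memC0Cp_smoothedFlux hh p)).congr hbi
  · exact (H.continuousOn_fluxPairing (hψ.of_le (by simp)) hc).congr (hpair ψ hψ hc)
  · rcases hcases t ht with rfl | rfl | ht'
    · rw [hρz, hbz]; exact hb₀i
    · rw [hρo, hbo]; exact hb₁i
    · exact (hce t ht').integrable_norm_sq_mul (H.memLp_processVelocity ht)
        (H.measurable_process ht) (hlaw t ht) (hmeas t ht) fun x => (hpos t ht x).le
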